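/- Let $d\in\mathbb N$, let $p\in[1,d/2)$ (so $d\ge 3$), and let $\|\cdot\|$ be an arbitrary norm on $\mathbb R^d$. For finite Borel measures $\mu,\nu$ on $\mathbb R^d$ of equal mass let $$\rho_p(\mu,\nu)=\inf_{\xi}\Bigl(\int_{\mathbb R^d\times\mathbb R^d}\|x-y\|^p\,\xi(\mathrm dx,\mathrm dy)\Bigr)^{1/p},$$ the infimum being over all measures $\xi$ on $\mathbb R^d\times\mathbb R^d$ with first marginal $\mu$ and second marginal $\nu$. For a probability measure $\mu$ on $\mathbb R^d$ let $\hat\mu_N=\frac1N\sum_{j=1}^N\delta_{X_j}$ with $X_1,\dots,X_N$ independent and $\mu$-distributed. For a cube $B$, write $\mathcal U(B)$ for the uniform distribution on $B$. A finite measure $\mu$ on $\mathbb R^d$ is called approachable from below if for every $\varepsilon>0$ there are finitely many cubes $B_1,\dots,B_n$ parallel to the coordinate axes and reals $\alpha_1,\dots,\alpha_n>0$ such that $\nu=\sum_{k}\alpha_k\,\mathcal U(B_k)$ satisfies $\nu\le\mu$ and $\|\mu-\nu\|\le\varepsilon$ in total variation. Let $\mathcal U=\mathcal U([0,1)^d)$.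 Then the limit $$\kappa_p^{\mathrm{unif}}=\lim_{N\to\infty}N^{1/d}\,\mathbb E\bigl[\rho_p^p(\mathcal U,\hat{\mathcal U}_N)\bigr]^{1/p}$$ exists and lies in $(0,\infty)$. Moreover, every compactly supported probability measure $\mu$ on $\mathbb R^d$ that is approachable from below is absolutely continuous with respect to Lebesgue measure $\lambda^d$, and $$\limsup_{N\to\infty}N^{1/d}\,\mathbb E\bigl[\rho_p^p(\mu,\hat\mu_N)\bigr]^{1/p}\le\kappa_p^{\mathrm{unif}}\left(\int_{\mathbb R^d}\Bigl(\frac{\mathrm d\mu}{\mathrm d\lambda^d}\Bigr)^{1-\frac pd}\,\mathrm d\lambda^d\right)^{1/p}.$$ -/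

import Mathlib

open MeasureTheory Filter Topology
open scoped ENNReal

namespace RandQuant

noncomputable section

/-- The half-open axis-parallel cube `∏ i, [a i, a i + s)` in `ℝ^d`. -/
def cube {d : ℕ} (a : Fin d → ℝ) (s : ℝ) : Set (Fin d → ℝ) :=
  Set.univ.pi fun i => Set.Ico (a i) (a i + s)

/-- The uniform distribution `𝒰(B)` on a Borel set `B ⊆ ℝ^d` of finite positive volume:
Lebesgue measure conditioned on `B`. -/
def unif {d : ℕ} (B : Set (Fin d → ℝ)) : Measure (Fin d → ℝ) :=
  ProbabilityTheory.cond volume B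

/-- The transports between `μ` and `ν`: measures on the product space whose first marginal
is `μ` and whose second marginal is `ν`. -/
def transports {d : ℕ} (μ ν : Measure (Fin d → ℝ)) :
    Set (Measure ((Fin d → ℝ) × (Fin d → ℝ))) :=
  {ξ | ξ.fst = μ ∧ ξ.snd = ν}

/-- The `p`-th Wasserstein metric `ρ_p(μ, ν)` for the cost `‖x - y‖ ^ p`, where the norm on
`ℝ^d` is given by `nrm`; it takes values in `[0, ∞]`. -/
def wasserstein {d : ℕ} (nrm : Seminorm ℝ (Fin d → ℝ)) (p : ℝ)
    (μ ν : Measure (Fin d → ℝ)) : ℝ≥0∞ :=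
  ⨅ ξ ∈ transports μ ν, (∫⁻ z, ENNReal.ofReal (nrm (z.1 - z.2) ^ p) ∂ξ) ^ (1 / p)

/-- The empirical measure `N⁻¹ ∑ j, δ_{x j}` of the sample `x 0, …, x (N - 1)`. -/
def empirical {d N : ℕ} (x : Fin N → Fin d → ℝ) : Measure (Fin d → ℝ) :=
  (N : ℝ≥0∞)⁻¹ • ∑ j, Measure.dirac (x j)

/-- The random quantization error `E[ρ_p(μ, μ̂_N) ^ p] ^ (1 / p)`, where `μ̂_N` is the empirical
measure of `N` independent `μ`-distributed points, i.e. of a sample with law `μ^{⊗ N}`. -/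
def randError {d : ℕ} (nrm : Seminorm ℝ (Fin d → ℝ)) (p : ℝ)
    (μ : Measure (Fin d → ℝ)) (N : ℕ) : ℝ≥0∞ :=
  (∫⁻ x, wasserstein nrm p μ (empirical x) ^ p ∂(Measure.pi fun _ : Fin N => μ)) ^ (1 / p)

/-- `μ` is approachable from below: for every `ε > 0` there are finitely many axis-parallel cubes
`B_k` and reals `α_k > 0` such that `ν = ∑ k, α_k 𝒰(B_k)` satisfies `ν ≤ μ` and `‖μ - ν‖ ≤ ε`.
As `ν ≤ μ`, the total variation norm of `μ - ν` is the total mass of the positive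
measure `μ - ν`. -/
def ApproachableFromBelow {d : ℕ} (μ : Measure (Fin d → ℝ)) : Prop :=
  ∀ ε : ℝ, 0 < ε → ∃ (n : ℕ) (a : Fin n → Fin d → ℝ) (s : Fin n → ℝ) (α : Fin n → ℝ),
    (∀ k, 0 < s k) ∧ (∀ k, 0 < α k) ∧
    (∑ k, ENNReal.ofReal (α k) • unif (cube (a k) (s k))) ≤ μ ∧
    (μ - ∑ k, ENNReal.ofReal (α k) • unif (cube (a k) (s k))) Set.univ ≤ ENNReal.ofReal ε

end

end RandQuant

namespace RandQuant

open scoped NNReal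

/-! Everything is proved for the `p`-th power of the Wasserstein distance, written as a transport
cost. This cost is subadditive over sums of measures and homogeneous under scaling by constants, so
mixtures can be treated component by component. The mean cost to an empirical measure is
nonincreasing in the sample size.

The central estimate concerns a mixture `∑ w k • μ k`. Conditionally on the labels of the sample
points, each component sees its own i.i.d. sample of random size. The part of `w k` that agrees with
the observed frequency is transported inside component `k`. The surplus is matched hierarchically
along coarser and coarser partitions: mass left unmatched at one level is moved inside the classes
of the next (`transportCost_mixture_le`). The expected unmatched mass at a level with `n` classes is
at most `√(n / N)`. For dyadic blocks in a grid of `K ^ d` cells the level costs form a geometric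
series with ratio `2 ^ (-(d / 2 - p))`. This is where `p < d / 2` enters, and the finest level
dominates.

With `K ≈ N ^ (1 / d)` this gives a mean cost of order at most `N ^ (-p / d)` for every law on a
cube (`exists_meanCost_le`); for the uniform law a volume argument gives the same order from below
(`exists_le_meanCost_unif`). For the uniform law each cell is a scaled copy of the whole cube, so
the normalised costs obey a recursive inequality up to small errors (`exists_meanCost_unif_le`);
this forces limsup and liminf to coincide and yields a limit `L = κ ^ p` in `(0, ∞)`.

A law approachable from below is, up to mass `ε`, bounded below by uniform laws on disjoint cells of
a single grid. A cell of side `h` and weight `β` contributes `β ^ (1 - p / d) * h ^ p * L` to the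
limsup, which is `L` times the integral over the cell of the constant density `β / h ^ d` raised to
the power `1 - p / d`. The remainder contributes at most a constant times `ε ^ (1 - p / d)`, which
vanishes as `ε → 0`. -/

/-- The optimal transport cost between `μ` and `ν` for the cost function `c`. -/
noncomputable def transportCost {d : ℕ} (c : (Fin d → ℝ) × (Fin d → ℝ) → ℝ≥0∞)
    (μ ν : Measure (Fin d → ℝ)) : ℝ≥0∞ :=
  ⨅ ξ ∈ transports μ ν, ∫⁻ z, c z ∂ξ

/-! ### Subadditivity, scaling and crude bounds for the transport cost. -/

section Transport

variable {d : ℕ} (c : (Fin d → ℝ) × (Fin d → ℝ) → ℝ≥0∞)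

theorem transportCost_le {μ ν : Measure (Fin d → ℝ)}
    {ξ : Measure ((Fin d → ℝ) × (Fin d → ℝ))} (h : ξ ∈ transports μ ν) :
    transportCost c μ ν ≤ ∫⁻ z, c z ∂ξ := iInf₂_le ξ h

theorem transportCost_add_le (μ₁ μ₂ ν₁ ν₂ : Measure (Fin d → ℝ)) :
    transportCost c (μ₁ + μ₂) (ν₁ + ν₂) ≤ transportCost c μ₁ ν₁ + transportCost c μ₂ ν₂ := by
  unfold transportCost
  simp only [ENNReal.iInf_add, ENNReal.add_iInf]
  refine le_iInf₂ fun ξ₂ h₂ => le_iInf₂ fun ξ₁ h₁ => ?_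
  have hmem : ξ₁ + ξ₂ ∈ transports (μ₁ + μ₂) (ν₁ + ν₂) :=
    ⟨by rw [Measure.fst_add, h₁.1, h₂.1], by rw [Measure.snd_add, h₁.2, h₂.2]⟩
  rw [← lintegral_add_measure]
  exact iInf₂_le _ hmem

theorem transportCost_zero : transportCost c (0 : Measure (Fin d → ℝ)) 0 = 0 := by
  refine le_antisymm ?_ zero_le
  exact (transportCost_le c (ξ := 0) ⟨by simp, by simp⟩).trans (by simp)

theorem transportCost_sum_le {ι : Type*} (s : Finset ι) (μ ν : ι → Measure (Fin d → ℝ)) :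
    transportCost c (∑ i ∈ s, μ i) (∑ i ∈ s, ν i) ≤ ∑ i ∈ s, transportCost c (μ i) (ν i) := by
  classical
  induction s using Finset.induction_on with
  | empty => simp [transportCost_zero]
  | insert i s hi ih =>
    rw [Finset.sum_insert hi, Finset.sum_insert hi, Finset.sum_insert hi]
    exact (transportCost_add_le c _ _ _ _).trans (by gcongr)

theorem transportCost_smul_le (a : ℝ≥0) (μ ν : Measure (Fin d → ℝ)) :
    transportCost c (a • μ) (a • ν) ≤ a * transportCost c μ ν := by
  rcases eq_or_ne a 0 with rfl | ha
  · simp [transportCost_zero]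
  unfold transportCost
  rw [ENNReal.mul_iInf_of_ne (by simpa using ha) (by simp)]
  refine le_iInf fun ξ => ?_
  rw [ENNReal.mul_iInf_of_ne (by simpa using ha) (by simp)]
  refine le_iInf fun h => ?_
  have hmem : a • ξ ∈ transports (a • μ) (a • ν) :=
    ⟨by rw [← h.1]; simp [Measure.fst, Measure.map_smul],
      by rw [← h.2]; simp [Measure.snd, Measure.map_smul]⟩
  exact (transportCost_le c hmem).trans_eq (lintegral_smul_measure a c)

/-- The product measure divided by the common mass is a coupling concentrated on `S ×ˢ S'`. -/
theorem transportCost_le_of_support {μ ν : Measure (Fin d → ℝ)} [IsFiniteMeasure μ]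
    [IsFiniteMeasure ν] (h : μ Set.univ = ν Set.univ) {S S' : Set (Fin d → ℝ)}
    (hμ : μ Sᶜ = 0) (hν : ν S'ᶜ = 0) {e : ℝ≥0∞}
    (he : ∀ x ∈ S, ∀ y ∈ S', c (x, y) ≤ e) :
    transportCost c μ ν ≤ e * μ Set.univ := by
  rcases eq_or_ne (μ Set.univ) 0 with h0 | h0
  · have h0' := h0
    rw [h] at h0'
    rw [Measure.measure_univ_eq_zero.1 h0, Measure.measure_univ_eq_zero.1 h0']
    simp [transportCost_zero]
  have htop : μ Set.univ ≠ ∞ := measure_ne_top _ _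
  have hmem : (μ Set.univ)⁻¹ • μ.prod ν ∈ transports μ ν := by
    constructor
    · simp only [Measure.fst, Measure.map_smul]
      rw [Measure.map_fst_prod, smul_smul, ← h, ENNReal.inv_mul_cancel h0 htop, one_smul]
    · simp only [Measure.snd, Measure.map_smul]
      rw [Measure.map_snd_prod, smul_smul, ENNReal.inv_mul_cancel h0 htop, one_smul]
  refine (transportCost_le c hmem).trans ?_
  rw [lintegral_smul_measure]
  have hae : ∀ᵐ z ∂μ.prod ν, c z ≤ e := by
    have h1 : ∀ᵐ z ∂μ.prod ν, z.1 ∈ S := by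
      have : ∀ᵐ x ∂μ, x ∈ S := hμ
      exact Measure.quasiMeasurePreserving_fst.ae this
    have h2 : ∀ᵐ z ∂μ.prod ν, z.2 ∈ S' := by
      have : ∀ᵐ x ∂ν, x ∈ S' := hν
      exact Measure.quasiMeasurePreserving_snd.ae this
    filter_upwards [h1, h2] with z hz1 hz2 using he _ hz1 _ hz2
  calc (μ Set.univ)⁻¹ • ∫⁻ z, c z ∂μ.prod ν
      ≤ (μ Set.univ)⁻¹ • ∫⁻ _, e ∂μ.prod ν := by
        simp only [smul_eq_mul]; gcongr 1; exact lintegral_mono_ae hae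
    _ = (μ Set.univ)⁻¹ * (e * (μ Set.univ * μ Set.univ)) := by
        rw [lintegral_const, ← Set.univ_prod_univ, Measure.prod_prod, ← h, smul_eq_mul]
    _ = e * μ Set.univ * ((μ Set.univ)⁻¹ * μ Set.univ) := by ring
    _ = e * μ Set.univ := by rw [ENNReal.inv_mul_cancel h0 htop, mul_one]

end Transport

/-! ### Hierarchical matching along a chain of coarser and coarser partitions. -/

section Matching

variable {I : Type*} [Fintype I] [DecidableEq I]

/-- The total weight of the class `F` of the partition given by `g`. -/
def classSum (g : I → I) (a : I → ℝ≥0) (F : I) : ℝ≥0 := ∑ k with g k = F, a k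

theorem sum_classSum (g : I → I) (a : I → ℝ≥0) : ∑ F, classSum g a F = ∑ k, a k :=
  Finset.sum_fiberwise _ _ _

theorem classSum_add (g : I → I) (a b : I → ℝ≥0) (F : I) :
    classSum g (fun k => a k + b k) F = classSum g a F + classSum g b F :=
  Finset.sum_add_distrib

theorem le_classSum (g : I → I) (a : I → ℝ≥0) (k : I) : a k ≤ classSum g a (g k) :=
  Finset.single_le_sum (f := a) (fun _ _ => zero_le) (by simp)

/-- Splitting off from `a` a part with prescribed class sums `t ≤ classSum g a`. -/
theorem exists_split (g : I → I) (a : I → ℝ≥0) (t : I → ℝ≥0) (ht : ∀ F, t F ≤ classSum g a F) :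
    ∃ a' a'' : I → ℝ≥0, (∀ k, a k = a' k + a'' k) ∧ (∀ F, classSum g a' F = t F) ∧
      ∀ F, classSum g a'' F = classSum g a F - t F := by
  -- All weights of a class are rescaled by the same factor. In a class of total weight zero the
  -- quotient is `0` by convention, which is right because `s` vanishes there too.
  have key : ∀ s : I → ℝ≥0, (∀ F, s F ≤ classSum g a F) → ∀ F,
      classSum g (fun k => a k * (s (g k) / classSum g a (g k))) F = s F := by
    intro s hs F
    have : classSum g (fun k => a k * (s (g k) / classSum g a (g k))) F =
        classSum g a F * (s F / classSum g a F) := by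
      rw [classSum, classSum, Finset.sum_mul]
      refine Finset.sum_congr rfl fun k hk => ?_
      rw [(Finset.mem_filter.1 hk).2]; rfl
    rw [this]
    rcases eq_or_ne (classSum g a F) 0 with h | h
    · have := hs F; rw [h] at this ⊢; simp at this; simp [this]
    · field_simp
  refine ⟨_, fun k => a k * ((classSum g a (g k) - t (g k)) / classSum g a (g k)), fun k => ?_,
    key t ht, key (fun F => classSum g a F - t F) fun F => tsub_le_self⟩
  rw [← mul_add, ← add_div, add_tsub_cancel_of_le (ht _)]
  rcases eq_or_ne (classSum g a (g k)) 0 with h | h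
  · have := le_classSum g a k; rw [h] at this; simp at this; simp [this]
  · field_simp

/-- By `hgh` every `h`-class is a disjoint union of `g`-classes, so its weight is a sum of `g`-class
weights. -/
theorem classSum_classSum {g h : I → I} (hgh : ∀ k k', g k = g k' → h k = h k')
    {a b : I → ℝ≥0} (hab : ∀ F, classSum g a F = classSum g b F) (F : I) :
    classSum h a F = classSum h b F := by
  have key : ∀ a : I → ℝ≥0, classSum h a F =
      ∑ G, if ∃ k, g k = G ∧ h k = F then classSum g a G else 0 := by
    intro a
    rw [classSum, ← Finset.sum_fiberwise _ g]
    refine Finset.sum_congr rfl fun G _ => ?_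
    split_ifs with hG
    · obtain ⟨k, hk, hkF⟩ := hG
      rw [classSum, Finset.filter_filter]
      refine Finset.sum_congr ?_ fun _ _ => rfl
      ext k'
      simp only [Finset.mem_filter, Finset.mem_univ, true_and]
      exact ⟨fun h => h.2, fun h' => ⟨by rw [← hkF]; exact hgh _ _ (h'.trans hk.symm), h'⟩⟩
    · refine Finset.sum_eq_zero fun k hk => (hG ⟨k, ?_⟩).elim
      simp only [Finset.mem_filter, Finset.mem_univ, true_and] at hk
      exact ⟨hk.2, hk.1⟩
  rw [key, key]; simp only [hab]

variable {d : ℕ} (c : (Fin d → ℝ) × (Fin d → ℝ) → ℝ≥0∞)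

theorem isFiniteMeasure_sum_smul {J : Type*} (s : Finset J) (a : J → ℝ≥0)
    (μ : J → Measure (Fin d → ℝ)) [∀ k, IsProbabilityMeasure (μ k)] :
    IsFiniteMeasure (∑ k ∈ s, a k • μ k) := by
  constructor
  rw [Measure.finsetSum_apply]
  exact ENNReal.sum_lt_top.2 fun k _ => by
    rw [Measure.smul_apply, measure_univ]; simp [ENNReal.smul_def]

theorem sum_smul_univ {J : Type*} (s : Finset J) (a : J → ℝ≥0)
    (μ : J → Measure (Fin d → ℝ)) [∀ k, IsProbabilityMeasure (μ k)] :
    (∑ k ∈ s, a k • μ k) Set.univ = ((∑ k ∈ s, a k : ℝ≥0) : ℝ≥0∞) := by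
  rw [Measure.finsetSum_apply, ENNReal.ofNNReal_finsetSum]
  exact Finset.sum_congr rfl fun k _ => by
    rw [Measure.smul_apply, measure_univ, ENNReal.smul_def, smul_eq_mul, mul_one]

/-- Transport inside the classes of a partition. -/
theorem transportCost_le_of_classSum_eq (μ ν : I → Measure (Fin d → ℝ))
    [∀ k, IsProbabilityMeasure (μ k)] [∀ k, IsProbabilityMeasure (ν k)]
    (S : I → Set (Fin d → ℝ)) (hμ : ∀ k, μ k (S k)ᶜ = 0) (hν : ∀ k, ν k (S k)ᶜ = 0)
    (g : I → I) {e : ℝ≥0∞}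
    (he : ∀ k k', g k = g k' → ∀ x ∈ S k, ∀ y ∈ S k', c (x, y) ≤ e)
    (a b : I → ℝ≥0) (hab : ∀ F, classSum g a F = classSum g b F) :
    transportCost c (∑ k, a k • μ k) (∑ k, b k • ν k) ≤ e * (∑ k, a k : ℝ≥0) := by
  rw [← Finset.sum_fiberwise (s := Finset.univ) (g := g) (f := fun k => a k • μ k),
    ← Finset.sum_fiberwise (s := Finset.univ) (g := g) (f := fun k => b k • ν k)]
  refine (transportCost_sum_le c _ _ _).trans ?_
  rw [← sum_classSum g a, ENNReal.ofNNReal_finsetSum, Finset.mul_sum]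
  refine Finset.sum_le_sum fun F _ => ?_
  have := isFiniteMeasure_sum_smul (Finset.univ.filter fun k => g k = F) a μ
  have := isFiniteMeasure_sum_smul (Finset.univ.filter fun k => g k = F) b ν
  have hS : ∀ (a : I → ℝ≥0) (μ : I → Measure (Fin d → ℝ)), (∀ k, μ k (S k)ᶜ = 0) →
      (∑ k with g k = F, a k • μ k) (⋃ k ∈ {k | g k = F}, S k)ᶜ = 0 := by
    intro a μ hμ
    rw [Measure.finsetSum_apply]
    refine Finset.sum_eq_zero fun k hk => ?_
    rw [Measure.smul_apply, measure_mono_null _ (hμ k), smul_zero]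
    refine Set.compl_subset_compl.2 (Set.subset_biUnion_of_mem (u := S) ?_)
    simpa using hk
  refine (transportCost_le_of_support c ?_ (hS a μ hμ) (hS b ν hν) (e := e) ?_).trans_eq ?_
  · rw [sum_smul_univ, sum_smul_univ]; exact congrArg _ (hab F)
  · intro x hx y hy
    simp only [Set.mem_iUnion, Set.mem_ofPred_eq] at hx hy
    obtain ⟨k, hk, hx⟩ := hx
    obtain ⟨k', hk', hy⟩ := hy
    exact he k k' (hk.trans hk'.symm) x hx y hy
  · rw [sum_smul_univ]; rfl

/-- Hierarchical matching: mass is matched inside the classes of finer partitions first, the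
unmatched mass is passed on to the next coarser partition. -/
theorem transportCost_hierarchical_le (μ ν : I → Measure (Fin d → ℝ))
    [∀ k, IsProbabilityMeasure (μ k)] [∀ k, IsProbabilityMeasure (ν k)]
    (S : I → Set (Fin d → ℝ)) (hμ : ∀ k, μ k (S k)ᶜ = 0) (hν : ∀ k, ν k (S k)ᶜ = 0)
    (cl : ℕ → I → I) (hcl : ∀ j k k', cl j k = cl j k' → cl (j + 1) k = cl (j + 1) k')
    (e : ℕ → ℝ≥0∞)
    (he : ∀ j k k', cl j k = cl j k' → ∀ x ∈ S k, ∀ y ∈ S k', c (x, y) ≤ e j)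
    (n j : ℕ) (hJ : ∀ k k', cl (j + n) k = cl (j + n) k') (a b : I → ℝ≥0)
    (hab : ∑ k, a k = ∑ k, b k) :
    transportCost c (∑ k, a k • μ k) (∑ k, b k • ν k) ≤ e j * (∑ k, a k : ℝ≥0) +
      ∑ i ∈ Finset.range n, e (j + i + 1) *
        (∑ F, (classSum (cl (j + i)) a F - classSum (cl (j + i)) b F) : ℝ≥0) := by
  induction n generalizing j a b with
  | zero =>
    simp only [Finset.range_zero, Finset.sum_empty, add_zero]
    refine transportCost_le_of_classSum_eq c μ ν S hμ hν (cl j) (he j) a b fun F => ?_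
    by_cases hF : ∃ k, cl j k = F
    · obtain ⟨k, hk⟩ := hF
      have : ∀ a : I → ℝ≥0, classSum (cl j) a F = ∑ k, a k := by
        intro a
        rw [classSum, Finset.filter_true_of_mem]
        intro k' _
        rw [← hk]; exact hJ _ _
      rw [this, this, hab]
    · have : (Finset.univ.filter fun k => cl j k = F) = ∅ := by
        ext k; simpa using fun h => hF ⟨k, h⟩
      simp [classSum, this]
  | succ n ih =>
    -- In each class of level `j` the smaller of the two masses is matched now; `a''` and `b''` are
    -- the surpluses handed to level `j + 1`.
    obtain ⟨a', a'', ha, ha', ha''⟩ := exists_split (cl j) a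
      (fun F => min (classSum (cl j) a F) (classSum (cl j) b F)) fun F => min_le_left _ _
    obtain ⟨b', b'', hb, hb', hb''⟩ := exists_split (cl j) b
      (fun F => min (classSum (cl j) a F) (classSum (cl j) b F)) fun F => min_le_right _ _
    have h1 : transportCost c (∑ k, a' k • μ k) (∑ k, b' k • ν k) ≤ e j * (∑ k, a k : ℝ≥0) := by
      refine (transportCost_le_of_classSum_eq c μ ν S hμ hν (cl j) (he j) a' b' fun F =>
        (ha' F).trans (hb' F).symm).trans ?_
      gcongr with k
      rw [ha k]; exact le_self_add
    have hsum' : ∑ k, a' k = ∑ k, b' k := by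
      rw [← sum_classSum (cl j) a', ← sum_classSum (cl j) b']
      exact Finset.sum_congr rfl fun F _ => (ha' F).trans (hb' F).symm
    have hsum : ∑ k, a'' k = ∑ k, b'' k := by
      simp only [ha, hb, Finset.sum_add_distrib, hsum'] at hab
      exact add_left_cancel hab
    have h2 := ih (j + 1) (fun k k' => by
      have := hJ k k'; rwa [show j + 1 + n = j + (n + 1) by ring]) a'' b'' hsum
    have hcl' : ∀ i k k', cl j k = cl j k' → cl (j + i) k = cl (j + i) k' := by
      intro i
      induction i with
      | zero => exact fun k k' h => h
      | succ i ih => exact fun k k' h => hcl _ _ _ (ih k k' h)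
    -- The matched parts have equal class sums at level `j`, hence at all coarser levels. They
    -- cancel, so the later deficits are those of the original `a` and `b`.
    have hdiff : ∀ i F, classSum (cl (j + i)) a'' F - classSum (cl (j + i)) b'' F =
        classSum (cl (j + i)) a F - classSum (cl (j + i)) b F := by
      intro i F
      have h1 : classSum (cl (j + i)) a F = classSum (cl (j + i)) a' F +
          classSum (cl (j + i)) a'' F := by rw [← classSum_add, ← funext ha]
      have h2 : classSum (cl (j + i)) b F = classSum (cl (j + i)) b' F +
          classSum (cl (j + i)) b'' F := by rw [← classSum_add, ← funext hb]
      have h3 : classSum (cl (j + i)) a' F = classSum (cl (j + i)) b' F :=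
        classSum_classSum (hcl' i) (fun F => (ha' F).trans (hb' F).symm) F
      rw [h1, h2, h3, add_tsub_add_eq_tsub_left]
    -- The mass passed on is exactly the deficit at level `j`. It is moved at cost at most `e (j +
    -- 1)`, which accounts for the index shift in the sum.
    have hlast : ∑ k, a'' k = ∑ F, (classSum (cl (j + 0)) a F - classSum (cl (j + 0)) b F) := by
      rw [← sum_classSum (cl j) a'']
      refine Finset.sum_congr rfl fun F _ => ?_
      rw [ha'', add_zero]
      rcases le_total (classSum (cl j) a F) (classSum (cl j) b F) with h | h
      · rw [min_eq_left h, tsub_self, tsub_eq_zero_of_le h]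
      · rw [min_eq_right h]
    have h3 : transportCost c (∑ k, a k • μ k) (∑ k, b k • ν k) ≤
        transportCost c (∑ k, a' k • μ k) (∑ k, b' k • ν k) +
        transportCost c (∑ k, a'' k • μ k) (∑ k, b'' k • ν k) := by
      simp only [ha, hb, add_smul, Finset.sum_add_distrib]
      exact transportCost_add_le c _ _ _ _
    refine h3.trans ((add_le_add h1 h2).trans_eq ?_)
    rw [Finset.sum_range_succ', hlast, add_comm (∑ i ∈ Finset.range n, _) _]
    congr 2
    refine Finset.sum_congr rfl fun i _ => ?_
    rw [show j + 1 + i = j + (i + 1) by ring]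
    simp only [hdiff]

/-- Matching each component with its counterpart first and the remaining mass hierarchically. -/
theorem transportCost_mixture_le (μ ν : I → Measure (Fin d → ℝ))
    [∀ k, IsProbabilityMeasure (μ k)] [∀ k, IsProbabilityMeasure (ν k)]
    (S : I → Set (Fin d → ℝ)) (hμ : ∀ k, μ k (S k)ᶜ = 0) (hν : ∀ k, ν k (S k)ᶜ = 0)
    (cl : ℕ → I → I) (hcl : ∀ j k k', cl j k = cl j k' → cl (j + 1) k = cl (j + 1) k')
    (e : ℕ → ℝ≥0∞)
    (he : ∀ j k k', cl j k = cl j k' → ∀ x ∈ S k, ∀ y ∈ S k', c (x, y) ≤ e j)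
    (n : ℕ) (hJ : ∀ k k', cl n k = cl n k') (w u : I → ℝ≥0)
    (hwu : ∑ k, w k = ∑ k, u k) :
    transportCost c (∑ k, w k • μ k) (∑ k, u k • ν k) ≤
      ∑ k, (min (w k) (u k) : ℝ≥0) * transportCost c (μ k) (ν k) +
      (e 0 * (∑ k, (w k - u k) : ℝ≥0) + ∑ i ∈ Finset.range n, e (i + 1) *
        (∑ F, (classSum (cl i) w F - classSum (cl i) u F) : ℝ≥0)) := by
  -- The common weight `min (w k) (u k)` stays inside component `k`; only the one-sided surpluses
  -- enter the hierarchy.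
  have hw : ∀ k, w k = min (w k) (u k) + (w k - u k) := fun k => by
    rcases le_total (w k) (u k) with h | h
    · rw [min_eq_left h, tsub_eq_zero_of_le h, add_zero]
    · rw [min_eq_right h, add_tsub_cancel_of_le h]
  have hu : ∀ k, u k = min (w k) (u k) + (u k - w k) := fun k => by
    rcases le_total (w k) (u k) with h | h
    · rw [min_eq_left h, add_tsub_cancel_of_le h]
    · rw [min_eq_right h, tsub_eq_zero_of_le h, add_zero]
  have h0 : transportCost c (∑ k, w k • μ k) (∑ k, u k • ν k) ≤
      transportCost c (∑ k, min (w k) (u k) • μ k) (∑ k, min (w k) (u k) • ν k) +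
      transportCost c (∑ k, (w k - u k) • μ k) (∑ k, (u k - w k) • ν k) := by
    conv_lhs => enter [2, 2, k]; rw [hw k, add_smul]
    conv_lhs => enter [3, 2, k]; rw [hu k, add_smul]
    rw [Finset.sum_add_distrib, Finset.sum_add_distrib]
    exact transportCost_add_le c _ _ _ _
  refine h0.trans (add_le_add ?_ ?_)
  · exact (transportCost_sum_le c _ _ _).trans
      (Finset.sum_le_sum fun k _ => transportCost_smul_le c _ _ _)
  · have hs : ∑ k, (w k - u k) = ∑ k, (u k - w k) := by
      rw [Finset.sum_congr rfl fun k _ => hw k, Finset.sum_congr rfl fun k _ => hu k,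
        Finset.sum_add_distrib, Finset.sum_add_distrib] at hwu
      exact add_left_cancel hwu
    refine (transportCost_hierarchical_le c μ ν S hμ hν cl hcl e he n 0
      (by simpa using hJ) _ _ hs).trans_eq ?_
    simp only [zero_add]
    have hdiff : ∀ i F, classSum (cl i) (fun k => w k - u k) F -
        classSum (cl i) (fun k => u k - w k) F = classSum (cl i) w F - classSum (cl i) u F := by
      intro i F
      have h1 : classSum (cl i) w F = classSum (cl i) (fun k => min (w k) (u k)) F +
          classSum (cl i) (fun k => w k - u k) F := by rw [← classSum_add, ← funext hw]
      have h2 : classSum (cl i) u F = classSum (cl i) (fun k => min (w k) (u k)) F +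
          classSum (cl i) (fun k => u k - w k) F := by rw [← classSum_add, ← funext hu]
      rw [h1, h2, add_tsub_add_eq_tsub_left]
    simp only [hdiff]

end Matching

/-! ### Transport to an empirical measure, and its measurability in the sample. -/

section Semidiscrete

variable {d : ℕ} {c : (Fin d → ℝ) × (Fin d → ℝ) → ℝ≥0∞}

theorem empirical_univ {N : ℕ} (hN : N ≠ 0) (x : Fin N → Fin d → ℝ) :
    empirical x Set.univ = 1 := by
  simp only [empirical, Measure.smul_apply, Measure.finsetSum_apply, measure_univ,
    Finset.sum_const, Finset.card_univ, Fintype.card_fin, nsmul_eq_mul, mul_one, smul_eq_mul]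
  exact ENNReal.inv_mul_cancel (by simpa using hN) (by simp)

theorem isProbabilityMeasure_empirical {N : ℕ} (hN : N ≠ 0) (x : Fin N → Fin d → ℝ) :
    IsProbabilityMeasure (empirical x) := ⟨empirical_univ hN x⟩

theorem lintegral_empirical {N : ℕ} (x : Fin N → Fin d → ℝ) (f : (Fin d → ℝ) → ℝ≥0∞) :
    ∫⁻ y, f y ∂empirical x = (N : ℝ≥0∞)⁻¹ * ∑ i, f (x i) := by
  rw [empirical, lintegral_smul_measure, lintegral_finsetSum_measure]
  simp

/-- The optimal transport problem to an empirical measure, in terms of the distributions of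
the mass sent to each of the points. -/
theorem transportCost_empirical (hc : Measurable c) {N : ℕ} (hN : N ≠ 0)
    (μ : Measure (Fin d → ℝ)) (x : Fin N → Fin d → ℝ) :
    transportCost c μ (empirical x) =
      ⨅ P : {P : Fin N → Measure (Fin d → ℝ) //
          (∀ i, IsProbabilityMeasure (P i)) ∧ (N : ℝ≥0∞)⁻¹ • ∑ i, P i = μ},
        (N : ℝ≥0∞)⁻¹ * ∑ i, ∫⁻ u, c (u, x i) ∂P.1 i := by
  refine le_antisymm (le_iInf ?_) (le_iInf₂ ?_)
  · rintro ⟨P, hP, hsum⟩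
    have hmem : (N : ℝ≥0∞)⁻¹ • ∑ i, (P i).prod (Measure.dirac (x i)) ∈
        transports μ (empirical x) := by
      constructor
      · rw [← hsum]
        ext s hs
        rw [Measure.fst_apply hs]
        simp only [Measure.smul_apply, Measure.finsetSum_apply]
        simp only [← Measure.fst_apply hs, Measure.fst_prod]
      · rw [empirical]
        ext s hs
        rw [Measure.snd_apply hs]
        simp only [Measure.smul_apply, Measure.finsetSum_apply]
        simp only [← Measure.snd_apply hs, Measure.snd_prod]
    refine (transportCost_le c hmem).trans_eq ?_
    rw [lintegral_smul_measure, lintegral_finsetSum_measure, smul_eq_mul]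
    congr 1
    refine Finset.sum_congr rfl fun i _ => ?_
    rw [lintegral_prod _ hc.aemeasurable]
    simp
  · intro ξ hξ
    have : IsProbabilityMeasure (empirical x) := isProbabilityMeasure_empirical hN x
    have hξp : IsProbabilityMeasure ξ := by
      constructor
      rw [← Measure.snd_univ, hξ.2, empirical_univ hN]
    -- After the swap the discrete marginal comes first, and the conditional laws at the sample
    -- points serve as the `P i`.
    set ρ := ξ.map Prod.swap with hρ
    have : IsProbabilityMeasure ρ := Measure.isProbabilityMeasure_map measurable_swap.aemeasurable
    have hfst : ρ.fst = empirical x := by rw [hρ, Measure.fst_map_swap, hξ.2]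
    have hsnd : ρ.snd = μ := by rw [hρ, Measure.snd_map_swap, hξ.1]
    have hdis := ρ.disintegrate ρ.condKernel
    have hint : ∀ f : (Fin d → ℝ) × (Fin d → ℝ) → ℝ≥0∞, Measurable f →
        ∫⁻ z, f z ∂ρ = (N : ℝ≥0∞)⁻¹ * ∑ i, ∫⁻ u, f (x i, u) ∂ρ.condKernel (x i) := by
      intro f hf
      conv_lhs => rw [← hdis]
      rw [Measure.lintegral_compProd hf, hfst, lintegral_empirical]
    have hmix : (N : ℝ≥0∞)⁻¹ • ∑ i, ρ.condKernel (x i) = μ := by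
      ext s hs
      rw [← hsnd, Measure.snd_apply hs, ← lintegral_indicator_one (measurable_snd hs), hint _
        (measurable_one.indicator (measurable_snd hs))]
      simp only [Measure.smul_apply, Measure.finsetSum_apply, smul_eq_mul]
      congr 1
      refine Finset.sum_congr rfl fun i _ => ?_
      rw [← lintegral_indicator_one hs]; rfl
    refine (iInf_le _ ⟨fun i => ρ.condKernel (x i), fun i => inferInstance, hmix⟩).trans_eq ?_
    · rw [← hint (fun z => c (z.2, z.1)) (hc.comp measurable_swap), hρ]
      exact lintegral_map (hc.comp measurable_swap) measurable_swap

/-- Dominated convergence: `c` is bounded on the product of `K` with a closed ball around `y`. -/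
theorem continuous_lintegral_of_isCompact (hc : Continuous c) (hc' : ∀ z, c z ≠ ∞)
    {K : Set (Fin d → ℝ)} (hK : IsCompact K) (P : Measure (Fin d → ℝ)) [IsFiniteMeasure P]
    (hP : P Kᶜ = 0) : Continuous fun y => ∫⁻ u, c (u, y) ∂P := by
  rw [continuous_iff_continuousAt]
  intro y
  obtain ⟨M, hM, hb⟩ : ∃ M : ℝ≥0∞, M ≠ ∞ ∧ ∀ u ∈ K, ∀ y' ∈ Metric.closedBall y 1,
      c (u, y') ≤ M := by
    rcases (K ×ˢ Metric.closedBall y 1).eq_empty_or_nonempty with h | h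
    · refine ⟨0, by simp, fun u hu y' hy' => ?_⟩
      have : (u, y') ∈ K ×ˢ Metric.closedBall y 1 := ⟨hu, hy'⟩
      simp [h] at this
    · obtain ⟨z, _, hz⟩ := (hK.prod (isCompact_closedBall y 1)).exists_isMaxOn h hc.continuousOn
      exact ⟨c z, hc' z, fun u hu y' hy' => hz ⟨hu, hy'⟩⟩
  refine tendsto_lintegral_filter_of_dominated_convergence (fun _ => M) ?_ ?_ ?_ ?_
  · exact Eventually.of_forall fun y' => hc.measurable.comp (by fun_prop)
  · filter_upwards [Metric.closedBall_mem_nhds y one_pos] with y' hy'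
    have : ∀ᵐ u ∂P, u ∈ K := hP
    filter_upwards [this] with u hu using hb u hu y' hy'
  · simpa using ENNReal.mul_ne_top hM (measure_ne_top _ _)
  · exact Eventually.of_forall fun u => (hc.comp (by fun_prop)).tendsto _

/-- In `transportCost_empirical` the family of admissible `P` does not depend on the sample. The
cost is therefore an infimum of continuous functions, which is upper semicontinuous although the
family is uncountable. -/
theorem measurable_transportCost_empirical (hc : Continuous c) (hc' : ∀ z, c z ≠ ∞)
    {K : Set (Fin d → ℝ)} (hK : IsCompact K) (μ : Measure (Fin d → ℝ)) (hμ : μ Kᶜ = 0) (N : ℕ) :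
    Measurable fun x : Fin N → Fin d → ℝ => transportCost c μ (empirical x) := by
  rcases eq_or_ne N 0 with rfl | hN
  · exact Subsingleton.measurable
  simp only [transportCost_empirical hc.measurable hN]
  refine (upperSemicontinuous_iInf fun P => Continuous.upperSemicontinuous ?_).measurable
  refine ENNReal.continuous_const_mul (by simpa using hN) |>.comp
    (continuous_finsetSum _ fun i _ => ?_)
  have := P.2.1 i
  refine (continuous_lintegral_of_isCompact hc hc' hK (P.1 i) ?_).comp (continuous_apply i)
  have h := hμ
  rw [← P.2.2, Measure.smul_apply, Measure.finsetSum_apply, smul_eq_mul, mul_eq_zero] at h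
  rcases h with h | h
  · simp at h
  · exact Finset.sum_eq_zero_iff.1 h i (Finset.mem_univ _)

end Semidiscrete

/-! ### The mean cost, its monotonicity in the sample size, and products of mixtures. -/

section Mean

/-- Subsamples of an independent sample are again independent samples with the corresponding laws.
-/
theorem map_pi_comp {ι κ α : Type*} [Fintype ι] [Fintype κ] [MeasurableSpace α]
    (μ : ι → Measure α) [∀ i, IsProbabilityMeasure (μ i)] {e : κ → ι} (he : e.Injective) :
    MeasurePreserving (fun (x : ι → α) k => x (e k)) (Measure.pi μ)
      (Measure.pi fun k => μ (e k)) := by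
  classical
  have hm : Measurable (fun (x : ι → α) k => x (e k)) := by fun_prop
  refine ⟨hm, (Measure.pi_eq fun s hs => ?_).symm⟩
  rw [Measure.map_apply hm (MeasurableSet.univ_pi hs)]
  -- The preimage of a box is a box: `s k` at coordinate `e k`, no constraint at coordinates outside
  -- the range of `e`.
  set t : ι → Set α := fun i => if h : ∃ k, e k = i then s h.choose else Set.univ with ht
  have hte : ∀ k, t (e k) = s k := by
    intro k
    have h : ∃ k', e k' = e k := ⟨k, rfl⟩
    rw [ht]
    simp only [h, dite_true]
    rw [he h.choose_spec]
  have : (fun (x : ι → α) k => x (e k)) ⁻¹' Set.univ.pi s = Set.univ.pi t := by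
    ext x
    simp only [Set.mem_preimage, Set.mem_univ_pi]
    constructor
    · intro h i
      by_cases hi : ∃ k, e k = i
      · obtain ⟨k, rfl⟩ := hi
        rw [hte]; exact h k
      · simp [ht, hi]
    · intro h k
      rw [← hte]; exact h _
  rw [this, Measure.pi_pi, ← Finset.prod_subset (Finset.subset_univ (Finset.univ.image e)),
    Finset.prod_image he.injOn]
  · simp only [hte]
  · intro i _ hi
    have : ¬ ∃ k, e k = i := fun ⟨k, hk⟩ => hi (Finset.mem_image.2 ⟨k, Finset.mem_univ _, hk⟩)
    simp [ht, this]

variable {d : ℕ} {c : (Fin d → ℝ) × (Fin d → ℝ) → ℝ≥0∞}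

/-- The mean transport cost from `μ` to the empirical measure of an i.i.d. sample of size `N`. -/
noncomputable def meanCost (c : (Fin d → ℝ) × (Fin d → ℝ) → ℝ≥0∞) (μ : Measure (Fin d → ℝ))
    (N : ℕ) : ℝ≥0∞ :=
  ∫⁻ x, transportCost c μ (empirical x) ∂(Measure.pi fun _ : Fin N => μ)

/-- Each index is omitted by exactly one of the `n + 1` leave-one-out families, so it is counted `n`
times. -/
theorem sum_sum_succAbove {M : Type*} [AddCommMonoid M] {n : ℕ} (f : Fin (n + 1) → M) :
    ∑ i : Fin (n + 1), ∑ j : Fin n, f (i.succAbove j) = n • ∑ i, f i := by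
  have h1 : ∀ i : Fin (n + 1), ∑ j : Fin n, f (i.succAbove j) = ∑ j with j ≠ i, f j := by
    intro i
    rw [← Finset.sum_image (f := f) (g := i.succAbove) (s := Finset.univ)
      (i.succAbove_right_injective.injOn), Fin.image_succAbove_univ]
    congr 1
    ext j; simp
  simp only [h1, Finset.sum_filter]
  rw [Finset.sum_comm, Finset.smul_sum]
  refine Finset.sum_congr rfl fun j _ => ?_
  rw [← Finset.sum_filter, Finset.sum_const]
  congr 1
  rw [Finset.filter_ne, Finset.card_erase_of_mem (Finset.mem_univ _)]
  simp

theorem empirical_eq_sum_succAbove {n : ℕ} (hn : n ≠ 0) (x : Fin (n + 1) → Fin d → ℝ) :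
    empirical x = ∑ i : Fin (n + 1),
      ((n + 1 : ℕ) : ℝ≥0)⁻¹ • empirical (fun j => x (i.succAbove j)) := by
  simp only [empirical]
  rw [← Finset.smul_sum, ← Finset.smul_sum,
    sum_sum_succAbove fun j => Measure.dirac (x j)]
  ext s hs
  simp only [Measure.smul_apply, smul_eq_mul, ENNReal.smul_def, nsmul_eq_mul]
  rw [← mul_assoc (n : ℝ≥0∞)⁻¹, ENNReal.inv_mul_cancel (by simpa using hn) (by simp), one_mul,
    ENNReal.coe_inv (by positivity)]
  simp

/-- The empirical measure of `n + 1` points is the average of its `n + 1` leave-one-out empirical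
measures. The transport cost is convex, and every leave-one-out sample has the law of an `n`-sample.
-/
theorem meanCost_succ_le (hc : Continuous c) (hc' : ∀ z, c z ≠ ∞)
    {K : Set (Fin d → ℝ)} (hK : IsCompact K) (μ : Measure (Fin d → ℝ)) [IsProbabilityMeasure μ]
    (hμ : μ Kᶜ = 0) {n : ℕ} (hn : n ≠ 0) : meanCost c μ (n + 1) ≤ meanCost c μ n := by
  have hmeas := measurable_transportCost_empirical hc hc' hK μ hμ n
  have hμs : μ = ∑ _i : Fin (n + 1), ((n + 1 : ℕ) : ℝ≥0)⁻¹ • μ := by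
    rw [Finset.sum_const, Finset.card_univ, Fintype.card_fin, ← Nat.cast_smul_eq_nsmul ℝ≥0,
      smul_smul, mul_inv_cancel₀ (by positivity), one_smul]
  calc meanCost c μ (n + 1)
      ≤ ∫⁻ x, ∑ i : Fin (n + 1), (((n + 1 : ℕ) : ℝ≥0)⁻¹ : ℝ≥0) *
          transportCost c μ (empirical fun j => x (i.succAbove j))
          ∂(Measure.pi fun _ : Fin (n + 1) => μ) := by
        refine lintegral_mono fun x => ?_
        dsimp only
        conv_lhs => rw [empirical_eq_sum_succAbove hn, hμs]
        exact (transportCost_sum_le c _ _ _).trans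
          (Finset.sum_le_sum fun i _ => transportCost_smul_le c _ _ _)
    _ = ∑ i : Fin (n + 1), (((n + 1 : ℕ) : ℝ≥0)⁻¹ : ℝ≥0) * meanCost c μ n := by
        rw [lintegral_finsetSum]
        · refine Finset.sum_congr rfl fun i _ => ?_
          have hp := map_pi_comp (fun _ : Fin (n + 1) => μ) (i.succAbove_right_injective)
          refine (lintegral_const_mul _ (hmeas.comp hp.measurable)).trans ?_
          rw [meanCost, ← hp.lintegral_comp hmeas]
          rfl
        · intro i _
          have hp := map_pi_comp (fun _ : Fin (n + 1) => μ) (i.succAbove_right_injective)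
          exact (hmeas.comp hp.measurable).const_mul _
    _ = meanCost c μ n := by
        rw [Finset.sum_const, Finset.card_univ, Fintype.card_fin, nsmul_eq_mul, ← mul_assoc,
          ENNReal.coe_inv (by positivity)]
        rw [ENNReal.coe_natCast, ENNReal.mul_inv_cancel (by simp) (by simp), one_mul]

theorem meanCost_anti (hc : Continuous c) (hc' : ∀ z, c z ≠ ∞)
    {K : Set (Fin d → ℝ)} (hK : IsCompact K) (μ : Measure (Fin d → ℝ)) [IsProbabilityMeasure μ]
    (hμ : μ Kᶜ = 0) {m n : ℕ} (hm : m ≠ 0) (hmn : m ≤ n) : meanCost c μ n ≤ meanCost c μ m := by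
  induction n, hmn using Nat.le_induction with
  | base => exact le_rfl
  | succ n hn ih => exact (meanCost_succ_le hc hc' hK μ hμ (by omega)).trans ih

/-- Sampling from a mixture amounts to drawing the labels `l` and then the points given their
labels; this is the expansion of the product measure. -/
theorem pi_sum_smul {I : Type*} [Fintype I] (w : I → ℝ≥0) (μ : I → Measure (Fin d → ℝ))
    [∀ k, IsProbabilityMeasure (μ k)] (N : ℕ) :
    Measure.pi (fun _ : Fin N => ∑ k, w k • μ k) =
      ∑ l : Fin N → I, (∏ j, w (l j)) • Measure.pi fun j => μ (l j) := by
  classical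
  have := isFiniteMeasure_sum_smul Finset.univ w μ
  refine Measure.pi_eq fun s hs => ?_
  simp only [Measure.finsetSum_apply, Measure.smul_apply, Measure.pi_pi, ENNReal.smul_def,
    smul_eq_mul]
  rw [Finset.prod_univ_sum, Fintype.piFinset_univ]
  refine Finset.sum_congr rfl fun l _ => ?_
  rw [Finset.prod_mul_distrib, ENNReal.ofNNReal_finsetProd]

end Mean

/-! ### Fluctuations of label frequencies, as finite sums over label sequences. -/

section Fluctuations

variable {I : Type*} [Fintype I]

theorem sum_prod_weights {R : Type*} [CommSemiring R] (w : I → R) (N : ℕ) :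
    ∑ l : Fin N → I, ∏ j, w (l j) = (∑ k, w k) ^ N := by
  classical
  have := (Finset.prod_univ_sum (fun _ : Fin N => (Finset.univ : Finset I)) fun _ k => w k).symm
  rw [Fintype.piFinset_univ] at this
  rw [this, Finset.prod_const, Finset.card_univ, Fintype.card_fin]

theorem sum_weights_ennreal (w : I → ℝ≥0) (hw : ∑ k, w k = 1) (N : ℕ) :
    ∑ l : Fin N → I, ((∏ j, w (l j) : ℝ≥0) : ℝ≥0∞) = 1 := by
  rw [← ENNReal.ofNNReal_finsetSum, sum_prod_weights, hw, one_pow, ENNReal.coe_one]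

/-- Splits off the first label; this drives the inductions on the sample size below. -/
theorem sum_fin_succ_fun {R : Type*} [AddCommMonoid R] (N : ℕ) (F : (Fin (N + 1) → I) → R) :
    ∑ l, F l = ∑ k, ∑ l : Fin N → I, F (Fin.cons k l) := by
  rw [← Fintype.sum_prod_type', ← (Fin.consEquiv fun _ : Fin (N + 1) => I).sum_comp]
  rfl

theorem sum_weights_sum_eq_zero (w f : I → ℝ) (hf : ∑ k, w k * f k = 0) (N : ℕ) :
    ∑ l : Fin N → I, (∏ j, w (l j)) * ∑ j, f (l j) = 0 := by
  induction N with
  | zero => simp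
  | succ N ih =>
    rw [sum_fin_succ_fun]
    simp only [Fin.prod_univ_succ, Fin.sum_univ_succ, Fin.cons_zero, Fin.cons_succ]
    have : ∀ k, ∑ l : Fin N → I, (w k * ∏ j, w (l j)) * (f k + ∑ j, f (l j)) =
        (w k * f k) * ∑ l : Fin N → I, ∏ j, w (l j) := by
      intro k
      have : ∀ l : Fin N → I, (w k * ∏ j, w (l j)) * (f k + ∑ j, f (l j)) =
        (w k * f k) * (∏ j, w (l j)) + w k * ((∏ j, w (l j)) * ∑ j, f (l j)) := fun l => by ring
      simp only [this, Finset.sum_add_distrib, ← Finset.mul_sum, ih, mul_zero, add_zero]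
    simp only [this, ← Finset.sum_mul, hf, zero_mul]

/-- The variance of a sum of i.i.d. centred variables. -/
theorem sum_weights_sq (w f : I → ℝ) (hw : ∑ k, w k = 1) (hf : ∑ k, w k * f k = 0) (N : ℕ) :
    ∑ l : Fin N → I, (∏ j, w (l j)) * (∑ j, f (l j)) ^ 2 = N * ∑ k, w k * f k ^ 2 := by
  induction N with
  | zero => simp
  | succ N ih =>
    rw [sum_fin_succ_fun]
    simp only [Fin.prod_univ_succ, Fin.sum_univ_succ, Fin.cons_zero, Fin.cons_succ]
    have : ∀ k, ∑ l : Fin N → I, (w k * ∏ j, w (l j)) * (f k + ∑ j, f (l j)) ^ 2 =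
        w k * f k ^ 2 + w k * (N * ∑ k, w k * f k ^ 2) := by
      intro k
      have : ∀ l : Fin N → I, (w k * ∏ j, w (l j)) * (f k + ∑ j, f (l j)) ^ 2 =
        (w k * f k ^ 2) * (∏ j, w (l j)) + 2 * w k * f k * ((∏ j, w (l j)) * ∑ j, f (l j)) +
        w k * ((∏ j, w (l j)) * (∑ j, f (l j)) ^ 2) := fun l => by ring
      simp only [this, Finset.sum_add_distrib, ← Finset.mul_sum, ih,
        sum_weights_sum_eq_zero w f hf, sum_prod_weights, hw, one_pow]
      ring
    simp only [this, Finset.sum_add_distrib, ← Finset.sum_mul, hw]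
    push_cast; ring

variable [DecidableEq I]

/-- The number of indices carrying the label `k`. -/
def count {N : ℕ} (l : Fin N → I) (k : I) : ℕ := (Finset.univ.filter fun j => l j = k).card

/-- The relative frequency of the label `k`. -/
noncomputable def freq {N : ℕ} (l : Fin N → I) (k : I) : ℝ≥0 := count l k / N

theorem sum_freq {N : ℕ} (hN : N ≠ 0) (l : Fin N → I) : ∑ k, freq l k = 1 := by
  simp only [freq, ← Finset.sum_div, ← Nat.cast_sum]
  have : ∑ k, count l k = N := by
    have := Finset.card_eq_sum_card_fiberwise (f := l) (s := Finset.univ) (t := Finset.univ)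
      (fun _ _ => by simp)
    simpa [count] using this.symm
  rw [this, div_self (by simpa using hN)]

theorem classSum_freq {N : ℕ} (g : I → I) (l : Fin N → I) (F : I) :
    classSum g (freq l) F = freq (fun j => g (l j)) F := by
  simp only [classSum, freq, ← Finset.sum_div, ← Nat.cast_sum]
  congr 2
  have := Finset.card_eq_sum_card_fiberwise (f := l)
    (s := Finset.univ.filter fun j => g (l j) = F) (t := Finset.univ.filter fun k => g k = F)
    (fun j hj => by simpa using hj)
  rw [count, this]
  refine Finset.sum_congr rfl fun k hk => ?_
  rw [count, Finset.filter_filter]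
  congr 1
  ext j
  simp only [Finset.mem_filter, Finset.mem_univ, true_and] at hk ⊢
  exact ⟨fun h => ⟨by rw [h, hk], h⟩, fun h => h.2⟩

/-- The class frequency is a mean of Bernoulli variables with parameter `W`, whose variance is `(W -
W ^ 2) / N ≤ W / N`. -/
theorem sum_weights_freq_sq_le (w : I → ℝ≥0) (hw : ∑ k, w k = 1) (g : I → I) (F : I) {N : ℕ}
    (hN : N ≠ 0) :
    ∑ l : Fin N → I, (∏ j, (w (l j) : ℝ)) *
      ((classSum g w F : ℝ) - classSum g (freq l) F) ^ 2 ≤ classSum g w F / N := by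
  have hN' : (N : ℝ) ≠ 0 := by simpa using hN
  set W : ℝ := ((classSum g w F : ℝ≥0) : ℝ) with hW
  have hWsum : W = ∑ k, (w k : ℝ) * (if g k = F then 1 else 0) := by
    rw [hW, classSum, NNReal.coe_sum, Finset.sum_filter]
    simp only [mul_ite, mul_one, mul_zero]
  have hw' : ∑ k, (w k : ℝ) = 1 := by exact_mod_cast hw
  set f : I → ℝ := fun k => W - if g k = F then 1 else 0 with hf
  have hf0 : ∑ k, (w k : ℝ) * f k = 0 := by
    simp only [hf, mul_sub, Finset.sum_sub_distrib, ← Finset.sum_mul, hw', ← hWsum]; ring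
  have hf2 : ∑ k, (w k : ℝ) * f k ^ 2 = W - W ^ 2 := by
    have : ∀ k, (w k : ℝ) * f k ^ 2 = w k * W ^ 2 + (1 - 2 * W) *
        (w k * (if g k = F then 1 else 0)) := by
      intro k; simp only [hf]; split_ifs <;> ring
    simp only [this, Finset.sum_add_distrib, ← Finset.sum_mul, ← Finset.mul_sum, hw', ← hWsum]
    ring
  have key := sum_weights_sq (fun k => (w k : ℝ)) f hw' hf0 N
  have hdiff : ∀ l : Fin N → I, W - (classSum g (freq l) F : ℝ) = (∑ j, f (l j)) / N := by
    intro l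
    rw [classSum_freq]
    simp only [hf, Finset.sum_sub_distrib, Finset.sum_const, Finset.card_univ, Fintype.card_fin,
      freq, count, Finset.sum_boole, nsmul_eq_mul, NNReal.coe_div, NNReal.coe_natCast]
    field_simp
  simp only [hdiff, div_pow, mul_div_assoc', ← Finset.sum_div, key, hf2]
  rw [div_le_div_iff₀ (by positivity) (by positivity)]
  nlinarith [sq_nonneg W, sq_nonneg (N : ℝ), mul_nonneg (sq_nonneg W) (sq_nonneg (N : ℝ))]

/-- Cauchy–Schwarz with respect to the label weights bounds the mean positive deviation by the
standard deviation. -/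
theorem sum_weights_deviation_le (w : I → ℝ≥0) (hw : ∑ k, w k = 1) (g : I → I) (F : I) {N : ℕ}
    (hN : N ≠ 0) :
    ∑ l : Fin N → I, (∏ j, (w (l j) : ℝ)) *
      ((classSum g w F - classSum g (freq l) F : ℝ≥0) : ℝ) ≤ √(classSum g w F / N) := by
  refine Real.le_sqrt_of_sq_le ((le_trans ?_ (sum_weights_freq_sq_le w hw g F hN)))
  have h := Finset.sum_sq_le_sum_mul_sum_of_sq_le_mul (Finset.univ : Finset (Fin N → I))
    (r := fun l => (∏ j, (w (l j) : ℝ)) *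
      ((classSum g w F - classSum g (freq l) F : ℝ≥0) : ℝ))
    (f := fun l => ∏ j, (w (l j) : ℝ)) (g := fun l => (∏ j, (w (l j) : ℝ)) *
      ((classSum g w F - classSum g (freq l) F : ℝ≥0) : ℝ) ^ 2)
    (fun l _ => by positivity) (fun l _ => by positivity) (fun l _ => le_of_eq (by ring))
  have hw' : ∑ k, (w k : ℝ) = 1 := by exact_mod_cast hw
  rw [sum_prod_weights (fun k => (w k : ℝ)), hw', one_pow, one_mul] at h
  refine h.trans (Finset.sum_le_sum fun l _ => ?_)
  refine mul_le_mul_of_nonneg_left ?_ (by positivity)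
  rcases le_total (classSum g w F) (classSum g (freq l) F) with h | h
  · rw [tsub_eq_zero_of_le h]; simpa using sq_nonneg _
  · rw [NNReal.coe_sub h]

/-- The expected total deviation of the class frequencies from the class probabilities. -/
theorem sum_weights_total_deviation_le (w : I → ℝ≥0) (hw : ∑ k, w k = 1) (g : I → I) {N : ℕ}
    (hN : N ≠ 0) :
    ∑ l : Fin N → I, ((∏ j, w (l j) : ℝ≥0) : ℝ≥0∞) *
      (∑ F, (classSum g w F - classSum g (freq l) F) : ℝ≥0) ≤
      ENNReal.ofReal √((Finset.univ.image g).card / N) := by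
  have hreal : ∑ l : Fin N → I, (∏ j, (w (l j) : ℝ)) *
      ∑ F, ((classSum g w F - classSum g (freq l) F : ℝ≥0) : ℝ) ≤
      √((Finset.univ.image g).card / N) := by
    simp only [Finset.mul_sum]
    rw [Finset.sum_comm, ← Finset.sum_subset (Finset.subset_univ (Finset.univ.image g))]
    · refine (Finset.sum_le_sum fun F _ => sum_weights_deviation_le w hw g F hN).trans ?_
      -- Cauchy–Schwarz over the nonempty classes only. Their number is what makes coarse levels
      -- cheap.
      refine Real.le_sqrt_of_sq_le (sq_sum_le_card_mul_sum_sq.trans ?_)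
      rw [Finset.sum_congr rfl fun F _ => Real.sq_sqrt (by positivity :
        (0 : ℝ) ≤ classSum g w F / N), ← Finset.sum_div, mul_div_assoc']
      gcongr
      refine mul_le_of_le_one_right (by positivity) ?_
      refine (Finset.sum_le_sum_of_subset_of_nonneg (Finset.subset_univ _)
        fun _ _ _ => by positivity).trans_eq ?_
      rw [← NNReal.coe_sum, sum_classSum, hw, NNReal.coe_one]
    · intro F _ hF
      have : (Finset.univ.filter fun k => g k = F) = ∅ := by
        ext k; simpa using fun h => hF (Finset.mem_image.2 ⟨k, Finset.mem_univ _, h⟩)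
      simp [classSum, this]
  refine le_trans (le_of_eq ?_) (ENNReal.ofReal_le_ofReal hreal)
  have : ∑ l : Fin N → I, (∏ j, (w (l j) : ℝ)) *
      ∑ F, ((classSum g w F - classSum g (freq l) F : ℝ≥0) : ℝ) =
      ((∑ l : Fin N → I, (∏ j, w (l j)) *
        ∑ F, (classSum g w F - classSum g (freq l) F) : ℝ≥0) : ℝ) := by
    simp only [NNReal.coe_sum, NNReal.coe_mul, NNReal.coe_prod]
  rw [this, ENNReal.ofReal_coe_nnreal, ENNReal.ofNNReal_finsetSum]
  simp only [ENNReal.coe_mul]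

/-- Chebyshev's inequality for the lower tail of the number of occurrences of a label. -/
theorem sum_weights_count_lt_le (w : I → ℝ≥0) (hw : ∑ k, w k = 1) (k : I) {N m : ℕ}
    (hN : N ≠ 0) {θ : ℝ} (hθ : 0 < θ) (hwk : w k ≠ 0) (hm : (m : ℝ) ≤ (1 - θ) * w k * N) :
    ∑ l : Fin N → I, ((∏ j, w (l j) : ℝ≥0) : ℝ≥0∞) * (if count l k < m then 1 else 0) ≤
      ENNReal.ofReal (1 / (θ ^ 2 * w k * N)) := by
  have hN' : (0 : ℝ) < N := by positivity
  have hwk' : (0 : ℝ) < w k := by positivity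
  have hreal : ∑ l : Fin N → I, (∏ j, (w (l j) : ℝ)) * (if count l k < m then 1 else 0) ≤
      1 / (θ ^ 2 * w k * N) := by
    have h := sum_weights_freq_sq_le w hw id k hN
    have hid : ∀ a : I → ℝ≥0, classSum id a k = a k := fun a => by
      simp [classSum, Finset.filter_eq']
    simp only [hid] at h
    -- If `count l k < m`, then `freq l k ≤ (1 - θ) * w k`. So the indicator is at most the squared
    -- deviation divided by `(θ * w k) ^ 2`.
    have h' : ∑ l : Fin N → I, (∏ j, (w (l j) : ℝ)) * (if count l k < m then 1 else 0) ≤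
        ∑ l : Fin N → I, (∏ j, (w (l j) : ℝ)) * ((w k : ℝ) - freq l k) ^ 2 *
          (1 / (θ * w k) ^ 2) := by
      refine Finset.sum_le_sum fun l _ => ?_
      rw [mul_assoc]
      refine mul_le_mul_of_nonneg_left ?_ (by positivity)
      split_ifs with hc
      · rw [mul_one_div, le_div_iff₀ (by positivity), one_mul]
        refine pow_le_pow_left₀ (by positivity) ?_ 2
        have hf : (freq l k : ℝ) ≤ (1 - θ) * w k := by
          rw [freq, NNReal.coe_div, NNReal.coe_natCast, NNReal.coe_natCast, div_le_iff₀ hN']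
          have : (count l k : ℝ) ≤ m := by exact_mod_cast hc.le
          linarith
        linarith
      · positivity
    refine h'.trans ?_
    rw [← Finset.sum_mul]
    refine (mul_le_mul_of_nonneg_right h (by positivity)).trans_eq ?_
    field_simp
  refine le_trans (le_of_eq ?_) (ENNReal.ofReal_le_ofReal hreal)
  have : ∑ l : Fin N → I, (∏ j, (w (l j) : ℝ)) * (if count l k < m then 1 else 0) =
      ((∑ l : Fin N → I, (∏ j, w (l j)) * (if count l k < m then 1 else 0) : ℝ≥0) : ℝ) := by
    simp only [NNReal.coe_sum, NNReal.coe_mul, NNReal.coe_prod]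
    refine Finset.sum_congr rfl fun l _ => ?_
    split_ifs <;> simp
  rw [this, ENNReal.ofReal_coe_nnreal, ENNReal.ofNNReal_finsetSum]
  refine Finset.sum_congr rfl fun l _ => ?_
  split_ifs <;> simp

end Fluctuations

/-! ### Mean transport cost of a mixture, conditionally on the labels. -/

section Mixture

variable {I : Type*} [DecidableEq I] {d : ℕ}
  {c : (Fin d → ℝ) × (Fin d → ℝ) → ℝ≥0∞}

/-- Enumeration of the indices carrying the label `k`. -/
def fiberEmb {N : ℕ} (l : Fin N → I) (k : I) : Fin (count l k) ↪o Fin N :=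
  (Finset.univ.filter fun j => l j = k).orderEmbOfFin rfl

theorem apply_fiberEmb {N : ℕ} (l : Fin N → I) (k : I) (i : Fin (count l k)) :
    l (fiberEmb l k i) = k := by
  have := Finset.orderEmbOfFin_mem (Finset.univ.filter fun j => l j = k) rfl i
  exact (Finset.mem_filter.1 this).2

theorem sum_fiberEmb {M : Type*} [AddCommMonoid M] {N : ℕ} (l : Fin N → I) (k : I)
    (f : Fin N → M) : ∑ i, f (fiberEmb l k i) = ∑ j with l j = k, f j := by
  rw [← Finset.map_orderEmbOfFin_univ (Finset.univ.filter fun j => l j = k) rfl, Finset.sum_map]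
  rfl

open Classical in
/-- The empirical measure of the sample points with label `k` (and `μ k` if there is none). -/
noncomputable def labelEmpirical {N : ℕ} (μ : I → Measure (Fin d → ℝ)) (l : Fin N → I)
    (x : Fin N → Fin d → ℝ) (k : I) : Measure (Fin d → ℝ) :=
  if count l k = 0 then μ k else empirical fun i => x (fiberEmb l k i)

theorem isProbabilityMeasure_labelEmpirical {N : ℕ} (μ : I → Measure (Fin d → ℝ))
    [∀ k, IsProbabilityMeasure (μ k)] (l : Fin N → I) (x : Fin N → Fin d → ℝ) (k : I) :
    IsProbabilityMeasure (labelEmpirical μ l x k) := by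
  unfold labelEmpirical
  split_ifs with h
  · infer_instance
  · exact isProbabilityMeasure_empirical h _

/-- Given the labels, the points with label `k` form an i.i.d. sample of `μ k` of size `count l k`.
-/
theorem lintegral_transportCost_labelEmpirical (hc : Continuous c) (hc' : ∀ z, c z ≠ ∞)
    {K : Set (Fin d → ℝ)} (hK : IsCompact K) (μ : I → Measure (Fin d → ℝ))
    [∀ k, IsProbabilityMeasure (μ k)] (hμ : ∀ k, μ k Kᶜ = 0) {N : ℕ} (l : Fin N → I) (k : I) :
    Measurable (fun x : Fin N → Fin d → ℝ => transportCost c (μ k) (labelEmpirical μ l x k)) ∧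
      (count l k ≠ 0 → ∫⁻ x, transportCost c (μ k) (labelEmpirical μ l x k)
        ∂(Measure.pi fun j => μ (l j)) = meanCost c (μ k) (count l k)) := by
  have hm := measurable_transportCost_empirical hc hc' hK (μ k) (hμ k) (count l k)
  have hp := map_pi_comp (fun j => μ (l j)) (fiberEmb l k).injective
  simp only [apply_fiberEmb] at hp
  constructor
  · unfold labelEmpirical
    split_ifs with h
    · exact measurable_const
    · exact hm.comp hp.measurable
  · intro h
    simp only [labelEmpirical, h, if_false]
    rw [meanCost, ← hp.lintegral_comp hm]

variable [Fintype I]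

theorem empirical_eq_sum_labelEmpirical {N : ℕ} (μ : I → Measure (Fin d → ℝ)) (l : Fin N → I)
    (x : Fin N → Fin d → ℝ) : empirical x = ∑ k, freq l k • labelEmpirical μ l x k := by
  rw [empirical, ← Finset.sum_fiberwise Finset.univ l, Finset.smul_sum]
  refine Finset.sum_congr rfl fun k _ => ?_
  rw [← sum_fiberEmb l k fun j => Measure.dirac (x j), labelEmpirical]
  split_ifs with h
  · have : IsEmpty (Fin (count l k)) := by rw [h]; infer_instance
    simp [freq, h]
  · rw [empirical, ENNReal.smul_def, smul_smul]
    congr 1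
    have hN : N ≠ 0 := by
      rintro rfl
      exact h (by simp [count])
    rw [freq, ENNReal.coe_div (by simpa using hN), ENNReal.coe_natCast, ENNReal.coe_natCast,
      div_eq_mul_inv, mul_comm (count l k : ℝ≥0∞), mul_assoc, ENNReal.mul_inv_cancel
      (by simpa using h) (by simp), mul_one]

/-- The mean transport cost of a mixture, by conditioning on the labels of the sample points. -/
theorem meanCost_mixture_le (hc : Continuous c) (hc' : ∀ z, c z ≠ ∞)
    {K : Set (Fin d → ℝ)} (hK : IsCompact K) (μ : I → Measure (Fin d → ℝ))
    [∀ k, IsProbabilityMeasure (μ k)] (hμK : ∀ k, μ k Kᶜ = 0)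
    (S : I → Set (Fin d → ℝ)) (hμ : ∀ k, μ k (S k)ᶜ = 0)
    (cl : ℕ → I → I) (hcl : ∀ j k k', cl j k = cl j k' → cl (j + 1) k = cl (j + 1) k')
    (e : ℕ → ℝ≥0∞)
    (he : ∀ j k k', cl j k = cl j k' → ∀ x ∈ S k, ∀ y ∈ S k', c (x, y) ≤ e j)
    (n : ℕ) (hJ : ∀ k k', cl n k = cl n k') (w : I → ℝ≥0) (hw : ∑ k, w k = 1)
    (v : I → ℕ → ℝ≥0∞) (hv : ∀ k, w k ≠ 0 → ∀ m, m ≠ 0 → meanCost c (μ k) m ≤ v k m)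
    {N : ℕ} (hN : N ≠ 0) :
    meanCost c (∑ k, w k • μ k) N ≤
      ∑ l : Fin N → I, ((∏ j, w (l j) : ℝ≥0) : ℝ≥0∞) *
        (∑ k, w k * v k (count l k) + (e 0 * (∑ k, (w k - freq l k) : ℝ≥0) +
          ∑ i ∈ Finset.range n, e (i + 1) *
            (∑ F, (classSum (cl i) w F - classSum (cl i) (freq l) F) : ℝ≥0))) := by
  rw [meanCost, pi_sum_smul, lintegral_finsetSum_measure]
  refine Finset.sum_le_sum fun l _ => ?_
  rw [lintegral_smul_measure, ENNReal.smul_def, smul_eq_mul]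
  gcongr
  set R : ℝ≥0∞ := e 0 * (∑ k, (w k - freq l k) : ℝ≥0) + ∑ i ∈ Finset.range n, e (i + 1) *
    (∑ F, (classSum (cl i) w F - classSum (cl i) (freq l) F) : ℝ≥0)
  have hae : ∀ᵐ x ∂(Measure.pi fun j => μ (l j)), ∀ j, x j ∈ S (l j) := by
    rw [ae_all_iff]
    intro j
    have : ∀ᵐ y ∂μ (l j), y ∈ S (l j) := hμ _
    exact (Measure.quasiMeasurePreserving_eval (fun j => μ (l j)) j).ae this
  have hbound : ∀ᵐ x ∂(Measure.pi fun j => μ (l j)),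
      transportCost c (∑ k, w k • μ k) (empirical x) ≤
        ∑ k, (min (w k) (freq l k) : ℝ≥0) * transportCost c (μ k) (labelEmpirical μ l x k) + R := by
    filter_upwards [hae] with x hx
    have := isProbabilityMeasure_labelEmpirical μ l x
    rw [empirical_eq_sum_labelEmpirical μ l x]
    refine transportCost_mixture_le c μ (labelEmpirical μ l x) S hμ (fun k => ?_) cl hcl e he n hJ
      w (freq l) (hw.trans (sum_freq hN l).symm)
    unfold labelEmpirical
    split_ifs with h
    · exact hμ k
    · rw [empirical, Measure.smul_apply, Measure.finsetSum_apply, Finset.sum_eq_zero, smul_zero]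
      intro i _
      have := hx (fiberEmb l k i)
      rw [apply_fiberEmb l k i] at this
      simp [this]
  refine (lintegral_mono_ae hbound).trans ?_
  rw [lintegral_add_right _ measurable_const, lintegral_const, measure_univ, mul_one]
  gcongr
  rw [lintegral_finsetSum]
  · refine Finset.sum_le_sum fun k _ => ?_
    obtain ⟨hm, hi⟩ := lintegral_transportCost_labelEmpirical hc hc' hK μ hμK l k
    rw [lintegral_const_mul _ hm]
    -- A component without sample points has frequency zero, hence no common weight to transport.
    by_cases h : count l k = 0
    · simp [freq, h]
    by_cases hk : w k = 0
    · simp [hk]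
    rw [hi h]
    gcongr
    · exact min_le_left _ _
    · exact hv k hk _ h
  · intro k _
    exact (lintegral_transportCost_labelEmpirical hc hc' hK μ hμK l k).1.const_mul _

/-- Averages the surpluses of all levels over the labels. The term with `e 0` belongs to the
partition into single components, hence `Fintype.card I`. -/
theorem sum_weights_leftover_le (cl : ℕ → I → I) (e : ℕ → ℝ≥0∞) (n : ℕ) (w : I → ℝ≥0)
    (hw : ∑ k, w k = 1) {N : ℕ} (hN : N ≠ 0) :
    ∑ l : Fin N → I, ((∏ j, w (l j) : ℝ≥0) : ℝ≥0∞) * (e 0 * (∑ k, (w k - freq l k) : ℝ≥0) +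
          ∑ i ∈ Finset.range n, e (i + 1) *
            (∑ F, (classSum (cl i) w F - classSum (cl i) (freq l) F) : ℝ≥0)) ≤
      e 0 * ENNReal.ofReal √(Fintype.card I / N) + ∑ i ∈ Finset.range n, e (i + 1) *
        ENNReal.ofReal √((Finset.univ.image (cl i)).card / N) := by
  simp only [mul_add, Finset.sum_add_distrib]
  refine add_le_add ?_ ?_
  · have h := sum_weights_total_deviation_le w hw id hN
    have hid : ∀ (a : I → ℝ≥0) k, classSum id a k = a k := fun a k => by
      simp [classSum, Finset.filter_eq']
    simp only [hid, Finset.image_id, Finset.card_univ] at h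
    refine le_trans (le_of_eq ?_) (mul_le_mul_right h (e 0))
    rw [Finset.mul_sum]
    exact Finset.sum_congr rfl fun l _ => by ring
  · simp only [Finset.mul_sum]
    rw [Finset.sum_comm]
    refine Finset.sum_le_sum fun i _ => ?_
    refine le_trans (le_of_eq ?_)
      (mul_le_mul_right (sum_weights_total_deviation_le w hw (cl i) hN) (e (i + 1)))
    rw [Finset.mul_sum]
    exact Finset.sum_congr rfl fun l _ => by ring

theorem transportCost_le_of_prob {μ ν : Measure (Fin d → ℝ)} [IsProbabilityMeasure μ]
    [IsProbabilityMeasure ν] {S : Set (Fin d → ℝ)} (hμ : μ Sᶜ = 0) (hν : ν Sᶜ = 0) {D : ℝ≥0∞}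
    (hD : ∀ x ∈ S, ∀ y ∈ S, c (x, y) ≤ D) : transportCost c μ ν ≤ D := by
  simpa using transportCost_le_of_support c (by simp) hμ hν hD

theorem meanCost_le_of_support (μ : Measure (Fin d → ℝ)) [IsProbabilityMeasure μ]
    {S : Set (Fin d → ℝ)} (hμ : μ Sᶜ = 0) {D : ℝ≥0∞} (hD : ∀ x ∈ S, ∀ y ∈ S, c (x, y) ≤ D)
    {N : ℕ} (hN : N ≠ 0) : meanCost c μ N ≤ D := by
  have hae : ∀ᵐ x ∂(Measure.pi fun _ : Fin N => μ), ∀ j, x j ∈ S := by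
    rw [ae_all_iff]
    intro j
    have : ∀ᵐ y ∂μ, y ∈ S := hμ
    exact (Measure.quasiMeasurePreserving_eval (fun _ : Fin N => μ) j).ae this
  calc meanCost c μ N ≤ ∫⁻ _, D ∂(Measure.pi fun _ : Fin N => μ) := by
        refine lintegral_mono_ae ?_
        filter_upwards [hae] with x hx
        have := isProbabilityMeasure_empirical hN x
        refine transportCost_le_of_prob hμ ?_ hD
        rw [empirical, Measure.smul_apply, Measure.finsetSum_apply, Finset.sum_eq_zero, smul_zero]
        intro i _
        simp [hx i]
    _ = D := by simp

/-- Upper bound for the mean transport cost of a mixture with a trivial bound for the cost inside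
the components. -/
theorem meanCost_mixture_le_of_diam (hc : Continuous c) (hc' : ∀ z, c z ≠ ∞)
    {K : Set (Fin d → ℝ)} (hK : IsCompact K) (μ : I → Measure (Fin d → ℝ))
    [∀ k, IsProbabilityMeasure (μ k)] (hμK : ∀ k, μ k Kᶜ = 0)
    (S : I → Set (Fin d → ℝ)) (hμ : ∀ k, μ k (S k)ᶜ = 0)
    (cl : ℕ → I → I) (hcl : ∀ j k k', cl j k = cl j k' → cl (j + 1) k = cl (j + 1) k')
    (e : ℕ → ℝ≥0∞)
    (he : ∀ j k k', cl j k = cl j k' → ∀ x ∈ S k, ∀ y ∈ S k', c (x, y) ≤ e j)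
    (n : ℕ) (hJ : ∀ k k', cl n k = cl n k') (w : I → ℝ≥0) (hw : ∑ k, w k = 1)
    {N : ℕ} (hN : N ≠ 0) :
    meanCost c (∑ k, w k • μ k) N ≤ e 0 +
      (e 0 * ENNReal.ofReal √(Fintype.card I / N) + ∑ i ∈ Finset.range n, e (i + 1) *
        ENNReal.ofReal √((Finset.univ.image (cl i)).card / N)) := by
  refine (meanCost_mixture_le hc hc' hK μ hμK S hμ cl hcl e he n hJ w hw (fun _ _ => e 0)
    (fun k _ m hm => meanCost_le_of_support (μ k) (hμ k) (he 0 k k rfl) hm) hN).trans ?_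
  simp only [mul_add _ (∑ k, (w k : ℝ≥0∞) * e 0), Finset.sum_add_distrib (f := fun l => _ * _)]
  refine add_le_add (le_of_eq ?_) (sum_weights_leftover_le cl e n w hw hN)
  rw [← Finset.sum_mul, ← Finset.sum_mul, sum_weights_ennreal w hw, ← ENNReal.ofNNReal_finsetSum,
    hw]
  simp

/-- Upper bound for the mean transport cost of a mixture in terms of the mean transport costs of
the components for a slightly reduced sample size. -/
theorem meanCost_mixture_le_of_meanCost (hc : Continuous c) (hc' : ∀ z, c z ≠ ∞)
    {K : Set (Fin d → ℝ)} (hK : IsCompact K) (μ : I → Measure (Fin d → ℝ))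
    [∀ k, IsProbabilityMeasure (μ k)] (hμK : ∀ k, μ k Kᶜ = 0)
    (S : I → Set (Fin d → ℝ)) (hμ : ∀ k, μ k (S k)ᶜ = 0)
    (cl : ℕ → I → I) (hcl : ∀ j k k', cl j k = cl j k' → cl (j + 1) k = cl (j + 1) k')
    (e : ℕ → ℝ≥0∞)
    (he : ∀ j k k', cl j k = cl j k' → ∀ x ∈ S k, ∀ y ∈ S k', c (x, y) ≤ e j)
    (n : ℕ) (hJ : ∀ k k', cl n k = cl n k') (w : I → ℝ≥0) (hw : ∑ k, w k = 1)
    {N : ℕ} (hN : N ≠ 0) {θ : ℝ} (hθ : 0 < θ) (m : I → ℕ)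
    (hm : ∀ k, w k ≠ 0 → m k ≠ 0 ∧ (m k : ℝ) ≤ (1 - θ) * w k * N) :
    meanCost c (∑ k, w k • μ k) N ≤
      ∑ k, (w k * meanCost c (μ k) (m k) + e 0 * ENNReal.ofReal (1 / (θ ^ 2 * N))) +
      (e 0 * ENNReal.ofReal √(Fintype.card I / N) + ∑ i ∈ Finset.range n, e (i + 1) *
        ENNReal.ofReal √((Finset.univ.image (cl i)).card / N)) := by
  have hN' : (0 : ℝ) < N := by positivity
  refine (meanCost_mixture_le hc hc' hK μ hμK S hμ cl hcl e he n hJ w hw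
    -- If at least `m k` points fall in component `k`, monotonicity in the sample size applies;
    -- otherwise the diameter bound `e 0` does.
    (fun k a => meanCost c (μ k) (m k) + e 0 * if a < m k then 1 else 0)
    (fun k hk a ha => ?_) hN).trans ?_
  · split_ifs with h
    · exact (meanCost_le_of_support (μ k) (hμ k) (he 0 k k rfl) ha).trans
        (by rw [mul_one]; exact le_add_self)
    · rw [mul_zero, add_zero]
      exact meanCost_anti hc hc' hK (μ k) (hμK k) (hm k hk).1 (not_lt.1 h)
  rw [Finset.sum_congr rfl fun l _ => mul_add _ (∑ k, _) _, Finset.sum_add_distrib]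
  refine add_le_add ?_ (sum_weights_leftover_le cl e n w hw hN)
  simp only [Finset.mul_sum]
  rw [Finset.sum_comm]
  refine Finset.sum_le_sum fun k _ => ?_
  by_cases hk : w k = 0
  · simp [hk]
  have hk' : (0 : ℝ) < w k := by positivity
  calc ∑ l : Fin N → I, ((∏ j, w (l j) : ℝ≥0) : ℝ≥0∞) * (w k * (meanCost c (μ k) (m k) +
        e 0 * if count l k < m k then 1 else 0))
      = w k * meanCost c (μ k) (m k) * ∑ l : Fin N → I, ((∏ j, w (l j) : ℝ≥0) : ℝ≥0∞) +
        e 0 * (w k * ∑ l : Fin N → I, ((∏ j, w (l j) : ℝ≥0) : ℝ≥0∞) *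
          if count l k < m k then 1 else 0) := by
        simp only [Finset.mul_sum, ← Finset.sum_add_distrib]
        exact Finset.sum_congr rfl fun l _ => by ring
    _ ≤ _ := by
        rw [sum_weights_ennreal w hw, mul_one]
        gcongr
        -- The factor `w k` cancels the one in Chebyshev's bound, so every component has the same
        -- error `1 / (θ ^ 2 * N)`.
        refine (mul_le_mul_right
          (sum_weights_count_lt_le w hw k hN hθ hk (hm k hk).2) _).trans_eq ?_
        rw [← ENNReal.ofReal_coe_nnreal, ← ENNReal.ofReal_mul (by positivity)]
        congr 1
        field_simp

end Mixture

/-! ### The cost `‖x - y‖ ^ p`: comparison with the sup norm, continuity, scaling. -/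

section Cost

variable {d : ℕ} (nrm : Seminorm ℝ (Fin d → ℝ)) (p : ℝ)

/-- The cost function `‖x - y‖ ^ p`. -/
noncomputable def costFn (z : (Fin d → ℝ) × (Fin d → ℝ)) : ℝ≥0∞ :=
  ENNReal.ofReal (nrm (z.1 - z.2) ^ p)

theorem exists_seminorm_le : ∃ B : ℝ, 0 < B ∧ ∀ x, nrm x ≤ B * ‖x‖ := by
  refine ⟨∑ i, nrm (Pi.single i 1) + 1,
    add_pos_of_nonneg_of_pos (Finset.sum_nonneg fun i _ => apply_nonneg _ _) one_pos, fun x => ?_⟩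
  calc nrm x = nrm (∑ i, x i • Pi.single i (1 : ℝ)) := by
        congr 1; exact pi_eq_sum_univ' x
    _ ≤ ∑ i, nrm (x i • Pi.single i (1 : ℝ)) :=
        Finset.le_sum_of_subadditive nrm (map_zero _).le (map_add_le_add nrm) _ _
    _ ≤ ∑ i, ‖x‖ * nrm (Pi.single i 1) := by
        refine Finset.sum_le_sum fun i _ => ?_
        rw [map_smul_eq_mul]
        gcongr
        exact norm_le_pi_norm x i
    _ ≤ _ := by
        rw [← Finset.mul_sum, mul_comm]
        gcongr
        linarith

theorem continuous_seminorm : Continuous nrm := by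
  obtain ⟨B, hB, h⟩ := exists_seminorm_le nrm
  refine (LipschitzWith.of_dist_le_mul (K := ⟨B, hB.le⟩) fun x y => ?_).continuous
  rw [Real.dist_eq, dist_eq_norm]
  exact (abs_sub_map_le_sub nrm x y).trans (h _)

theorem exists_le_seminorm (hnrm : ∀ x, nrm x = 0 → x = 0) :
    ∃ b : ℝ, 0 < b ∧ ∀ x, b * ‖x‖ ≤ nrm x := by
  rcases (Metric.sphere (0 : Fin d → ℝ) 1).eq_empty_or_nonempty with h | h
  · refine ⟨1, one_pos, fun x => ?_⟩
    rcases eq_or_ne x 0 with rfl | hx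
    · simp
    · have : ‖x‖⁻¹ • x ∈ Metric.sphere (0 : Fin d → ℝ) 1 := by
        simp [norm_smul, hx]
      simp [h] at this
  · obtain ⟨x₀, hx₀, hmin⟩ := (isCompact_sphere (0 : Fin d → ℝ) 1).exists_isMinOn h
      (continuous_seminorm nrm).continuousOn
    have hpos : 0 < nrm x₀ := by
      refine lt_of_le_of_ne (apply_nonneg _ _) fun h0 => ?_
      have := hnrm _ h0.symm
      simp [this] at hx₀
    refine ⟨nrm x₀, hpos, fun x => ?_⟩
    rcases eq_or_ne x 0 with rfl | hx
    · simp
    · have hmem : ‖x‖⁻¹ • x ∈ Metric.sphere (0 : Fin d → ℝ) 1 := by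
        simp [norm_smul, hx]
      have := isMinOn_iff.1 hmin _ hmem
      rw [map_smul_eq_mul, norm_inv, norm_norm] at this
      have hx' : 0 < ‖x‖ := norm_pos_iff.2 hx
      calc nrm x₀ * ‖x‖ ≤ ‖x‖⁻¹ * nrm x * ‖x‖ := by gcongr
        _ = nrm x := by field_simp

variable {p}

theorem continuous_costFn (hp : 0 ≤ p) : Continuous (costFn nrm p) := by
  refine ENNReal.continuous_ofReal.comp (Continuous.rpow_const ?_ fun _ => Or.inr hp)
  exact (continuous_seminorm nrm).comp (continuous_fst.sub continuous_snd)

theorem costFn_ne_top (z : (Fin d → ℝ) × (Fin d → ℝ)) : costFn nrm p z ≠ ∞ :=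
  ENNReal.ofReal_ne_top

/-- The map `x ↦ x ^ p` is an order isomorphism of `[0, ∞]`, so it commutes with the infimum over
couplings. -/
theorem wasserstein_rpow (hp : 0 < p) (μ ν : Measure (Fin d → ℝ)) :
    wasserstein nrm p μ ν ^ p = transportCost (costFn nrm p) μ ν := by
  unfold wasserstein transportCost
  have : ∀ f : ℝ≥0∞, f ^ p = ENNReal.orderIsoRpow p hp f := fun f => rfl
  rw [this]
  simp only [OrderIso.map_iInf, ENNReal.orderIsoRpow_apply, ← ENNReal.rpow_mul,
    one_div_mul_cancel hp.ne', ENNReal.rpow_one]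
  rfl

theorem randError_eq (hp : 0 < p) (μ : Measure (Fin d → ℝ)) (N : ℕ) :
    randError nrm p μ N = meanCost (costFn nrm p) μ N ^ (1 / p) := by
  simp only [randError, meanCost, wasserstein_rpow nrm hp]

theorem costFn_le (hp : 0 ≤ p) {B : ℝ} (hB : 0 < B) (h : ∀ x, nrm x ≤ B * ‖x‖) {r : ℝ}
    {x y : Fin d → ℝ} (hr : 0 ≤ r) (hxy : ∀ i, |x i - y i| ≤ r) :
    costFn nrm p (x, y) ≤ ENNReal.ofReal ((B * r) ^ p) := by
  refine ENNReal.ofReal_le_ofReal (Real.rpow_le_rpow (apply_nonneg _ _) ?_ hp)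
  refine (h _).trans (mul_le_mul_of_nonneg_left ?_ hB.le)
  exact (pi_norm_le_iff_of_nonneg hr).2 hxy

/-- Push a coupling forward in both coordinates: the translation cancels in the difference and the
dilation factors out as `s ^ p`. -/
theorem transportCost_map_le (hp : 0 ≤ p) {s : ℝ} (hs : 0 < s) (a : Fin d → ℝ)
    (μ ν : Measure (Fin d → ℝ)) :
    transportCost (costFn nrm p) (μ.map fun x => a + s • x) (ν.map fun x => a + s • x) ≤
      ENNReal.ofReal (s ^ p) * transportCost (costFn nrm p) μ ν := by
  have hg : Measurable fun x : Fin d → ℝ => a + s • x := by fun_prop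
  have hs' : 0 < s ^ p := by positivity
  conv_rhs => rw [transportCost]
  rw [ENNReal.mul_iInf_of_ne (by simpa using hs') ENNReal.ofReal_ne_top]
  refine le_iInf fun ξ => ?_
  rw [ENNReal.mul_iInf_of_ne (by simpa using hs') ENNReal.ofReal_ne_top]
  refine le_iInf fun hξ => ?_
  have hmem : ξ.map (Prod.map (fun x => a + s • x) fun x => a + s • x) ∈
      transports (μ.map fun x => a + s • x) (ν.map fun x => a + s • x) := by
    constructor
    · rw [← hξ.1, Measure.fst, Measure.fst, Measure.map_map measurable_fst (hg.prodMap hg),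
        Measure.map_map hg measurable_fst]
      rfl
    · rw [← hξ.2, Measure.snd, Measure.snd, Measure.map_map measurable_snd (hg.prodMap hg),
        Measure.map_map hg measurable_snd]
      rfl
  refine (transportCost_le _ hmem).trans_eq ?_
  have hc := (continuous_costFn nrm hp).measurable
  rw [lintegral_map hc (hg.prodMap hg), ← lintegral_const_mul _ hc]
  refine lintegral_congr fun z => ?_
  rw [costFn, costFn, ← ENNReal.ofReal_mul hs'.le, ← Real.mul_rpow hs.le (apply_nonneg _ _)]
  simp only [Prod.map_fst, Prod.map_snd, add_sub_add_left_eq_sub, ← smul_sub, map_smul_eq_mul,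
    Real.norm_of_nonneg hs.le]

theorem empirical_map {N : ℕ} {g : (Fin d → ℝ) → Fin d → ℝ} (hg : Measurable g)
    (x : Fin N → Fin d → ℝ) : empirical (fun i => g (x i)) = (empirical x).map g := by
  rw [empirical, empirical, Measure.map_smul, Measure.map_finset_sum' hg.aemeasurable]
  simp only [Measure.map_dirac' hg]

theorem meanCost_map_le (hp : 0 ≤ p) {s : ℝ} (hs : 0 < s) (a : Fin d → ℝ)
    (μ : Measure (Fin d → ℝ)) [IsProbabilityMeasure μ] {K : Set (Fin d → ℝ)} (hK : IsCompact K)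
    (hμ : μ Kᶜ = 0) (N : ℕ) :
    meanCost (costFn nrm p) (μ.map fun x => a + s • x) N ≤
      ENNReal.ofReal (s ^ p) * meanCost (costFn nrm p) μ N := by
  set g : (Fin d → ℝ) → Fin d → ℝ := fun x => a + s • x with hgdef
  have hgc : Continuous g := by fun_prop
  have hg : Measurable g := hgc.measurable
  have : IsProbabilityMeasure (μ.map g) := Measure.isProbabilityMeasure_map hg.aemeasurable
  have hμ' : (μ.map g) (g '' K)ᶜ = 0 := by
    rw [Measure.map_apply hg (hK.image hgc).measurableSet.compl]
    refine measure_mono_null (fun x hx hxK => hx ⟨x, hxK, rfl⟩) hμ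
  have hc := continuous_costFn nrm hp
  have hm := measurable_transportCost_empirical hc (costFn_ne_top nrm) (hK.image hgc) _ hμ' N
  have hmp : MeasurePreserving (fun (x : Fin N → Fin d → ℝ) i => g (x i))
      (Measure.pi fun _ => μ) (Measure.pi fun _ => μ.map g) :=
    measurePreserving_pi _ _ fun _ => ⟨hg, rfl⟩
  rw [meanCost, ← hmp.lintegral_comp hm, meanCost, ← lintegral_const_mul _
    (measurable_transportCost_empirical hc (costFn_ne_top nrm) hK μ hμ N)]
  refine lintegral_mono fun x => ?_
  dsimp only
  rw [empirical_map hg]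
  exact transportCost_map_le nrm hp hs a μ _

end Cost

/-! ### Cubes, grid cells and dyadic blocks of cells. -/

section Cubes

variable {d : ℕ}

theorem measurableSet_cube (a : Fin d → ℝ) (s : ℝ) : MeasurableSet (cube a s) :=
  MeasurableSet.univ_pi fun _ => measurableSet_Ico

theorem volume_cube (a : Fin d → ℝ) {s : ℝ} : volume (cube a s) = ENNReal.ofReal s ^ d := by
  simp [cube, Real.volume_pi_Ico]

theorem mem_cube {a : Fin d → ℝ} {s : ℝ} {x : Fin d → ℝ} :
    x ∈ cube a s ↔ ∀ i, a i ≤ x i ∧ x i < a i + s := by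
  simp [cube]

theorem cube_subset_Icc (a : Fin d → ℝ) (s : ℝ) :
    cube a s ⊆ Set.Icc a (fun i => a i + s) := by
  intro x hx
  rw [mem_cube] at hx
  exact ⟨fun i => (hx i).1, fun i => (hx i).2.le⟩

theorem volume_cube_ne_zero (a : Fin d → ℝ) {s : ℝ} (hs : 0 < s) : volume (cube a s) ≠ 0 := by
  rw [volume_cube]; exact pow_ne_zero _ (by simpa using hs)

theorem volume_cube_ne_top (a : Fin d → ℝ) (s : ℝ) : volume (cube a s) ≠ ∞ := by
  rw [volume_cube]; exact ENNReal.pow_ne_top ENNReal.ofReal_ne_top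

theorem isProbabilityMeasure_unif (a : Fin d → ℝ) {s : ℝ} (hs : 0 < s) :
    IsProbabilityMeasure (unif (cube a s)) :=
  ProbabilityTheory.cond_isProbabilityMeasure_of_finite (volume_cube_ne_zero a hs)
    (volume_cube_ne_top a s)

theorem unif_cube (a : Fin d → ℝ) (s : ℝ) :
    unif (cube a s) = (ENNReal.ofReal s ^ d)⁻¹ • volume.restrict (cube a s) := by
  rw [unif, ProbabilityTheory.cond, volume_cube]

theorem unif_cube_compl (a : Fin d → ℝ) (s : ℝ) : unif (cube a s) (cube a s)ᶜ = 0 := by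
  rw [unif_cube, Measure.smul_apply, Measure.restrict_apply (measurableSet_cube a s).compl]
  simp

theorem volume_restrict_cube (a : Fin d → ℝ) {s : ℝ} (hs : 0 < s) :
    volume.restrict (cube a s) = ENNReal.ofReal s ^ d • unif (cube a s) := by
  rw [unif_cube, smul_smul, ENNReal.mul_inv_cancel, one_smul]
  · exact pow_ne_zero _ (by simpa using hs)
  · exact ENNReal.pow_ne_top ENNReal.ofReal_ne_top

open scoped Pointwise in
theorem unif_cube_eq_map (a : Fin d → ℝ) {s : ℝ} (hs : 0 < s) :
    unif (cube a s) = (unif (cube (0 : Fin d → ℝ) 1)).map fun x => a + s • x := by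
  have hg : Measurable fun x : Fin d → ℝ => a + s • x := by fun_prop
  ext t ht
  rw [Measure.map_apply hg ht, unif_cube, unif_cube, Measure.smul_apply, Measure.smul_apply,
    Measure.restrict_apply ht, Measure.restrict_apply (hg ht)]
  have hpre : t ∩ cube a s = (fun x => a + x) '' (s • ((fun x => a + s • x) ⁻¹' t ∩ cube 0 1)) := by
    ext x
    simp only [Set.mem_inter_iff, Set.mem_image, Set.mem_smul_set, Set.mem_preimage]
    constructor
    · rintro ⟨hxt, hx⟩
      rw [mem_cube] at hx
      have hx' : a + s • (s⁻¹ • (x - a)) = x := by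
        rw [smul_inv_smul₀ hs.ne']; simp
      refine ⟨x - a, ⟨s⁻¹ • (x - a), ⟨by rwa [hx'], mem_cube.2 fun i => ?_⟩, ?_⟩, by simp⟩
      · simp only [Pi.smul_apply, Pi.sub_apply, smul_eq_mul, Pi.zero_apply, zero_add]
        rw [inv_mul_eq_div, div_lt_one hs]
        exact ⟨div_nonneg (by linarith [hx i]) hs.le, by linarith [hx i]⟩
      · rw [smul_inv_smul₀ hs.ne']
    · rintro ⟨_, ⟨y, ⟨hyt, hy⟩, rfl⟩, rfl⟩
      rw [mem_cube] at hy
      refine ⟨hyt, mem_cube.2 fun i => ?_⟩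
      have := hy i
      simp only [Pi.zero_apply, zero_add] at this
      simp only [Pi.add_apply, Pi.smul_apply, smul_eq_mul]
      exact ⟨by nlinarith, by nlinarith⟩
  rw [hpre, Set.image_add_left, measure_preimage_add, Measure.addHaar_smul]
  simp only [Module.finrank_fin_fun, abs_of_pos (pow_pos hs d), smul_eq_mul, ENNReal.ofReal_one,
    one_pow, inv_one, one_mul]
  rw [ENNReal.ofReal_pow hs.le, ← mul_assoc, ENNReal.inv_mul_cancel, one_mul]
  · exact pow_ne_zero _ (by simpa using hs)
  · exact ENNReal.pow_ne_top ENNReal.ofReal_ne_top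

theorem meanCost_unif_cube_le (nrm : Seminorm ℝ (Fin d → ℝ)) {p : ℝ} (hp : 0 ≤ p)
    (a : Fin d → ℝ) {s : ℝ} (hs : 0 < s) (N : ℕ) :
    meanCost (costFn nrm p) (unif (cube a s)) N ≤
      ENNReal.ofReal (s ^ p) * meanCost (costFn nrm p) (unif (cube (0 : Fin d → ℝ) 1)) N := by
  have := isProbabilityMeasure_unif (0 : Fin d → ℝ) one_pos
  rw [unif_cube_eq_map a hs]
  exact meanCost_map_le nrm hp hs a _ (K := Set.Icc 0 fun i => (0 : Fin d → ℝ) i + 1) isCompact_Icc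
    (measure_mono_null (Set.compl_subset_compl.2 (cube_subset_Icc _ _)) (unif_cube_compl 0 1)) N

/-- The cell with index `z` of the grid of mesh size `h` with origin `a`. -/
def gridCell (a : Fin d → ℝ) (h : ℝ) (z : Fin d → ℤ) : Set (Fin d → ℝ) :=
  cube (fun i => a i + h * z i) h

theorem mem_gridCell {a : Fin d → ℝ} {h : ℝ} (hh : 0 < h) {z : Fin d → ℤ} {x : Fin d → ℝ} :
    x ∈ gridCell a h z ↔ ∀ i, ⌊(x i - a i) / h⌋ = z i := by
  rw [gridCell, mem_cube]
  refine forall_congr' fun i => ?_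
  rw [Int.floor_eq_iff, le_div_iff₀ hh, div_lt_iff₀ hh]
  constructor <;> rintro ⟨h1, h2⟩ <;> constructor <;> linarith

theorem disjoint_gridCell {a : Fin d → ℝ} {h : ℝ} (hh : 0 < h) {z z' : Fin d → ℤ}
    (hz : z ≠ z') : Disjoint (gridCell a h z) (gridCell a h z') := by
  rw [Set.disjoint_left]
  intro x hx hx'
  rw [mem_gridCell hh] at hx hx'
  exact hz (funext fun i => (hx i).symm.trans (hx' i))

/-- The cell with index `z` in the partition of `cube a s` into `K ^ d` cells. -/
noncomputable def subCell (a : Fin d → ℝ) (s : ℝ) {K : ℕ} (z : Fin d → Fin K) :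
    Set (Fin d → ℝ) :=
  gridCell a (s / K) fun i => ((z i : ℕ) : ℤ)

theorem iUnion_subCell (a : Fin d → ℝ) {s : ℝ} (hs : 0 < s) {K : ℕ} (hK : 0 < K) :
    ⋃ z : Fin d → Fin K, subCell a s z = cube a s := by
  have hK' : (0 : ℝ) < K := by positivity
  have hh : 0 < s / K := by positivity
  ext x
  simp only [Set.mem_iUnion, subCell, mem_gridCell hh]
  rw [mem_cube]
  constructor
  · rintro ⟨z, hz⟩ i
    have h := hz i
    rw [Int.floor_eq_iff, le_div_iff₀ hh, div_lt_iff₀ hh] at h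
    obtain ⟨h1, h2⟩ := h
    have h3 : ((z i : ℕ) : ℝ) + 1 ≤ K := by exact_mod_cast (z i).2
    have h4 : (((z i : ℕ) : ℝ) + 1) * (s / K) ≤ s := by
      calc (((z i : ℕ) : ℝ) + 1) * (s / K) ≤ K * (s / K) := by gcongr
        _ = s := by field_simp
    have h5 : 0 ≤ ((z i : ℕ) : ℝ) * (s / K) := by positivity
    push_cast at h1 h2
    constructor <;> linarith
  · intro hx
    have h0 : ∀ i, 0 ≤ ⌊(x i - a i) / (s / K)⌋ := fun i =>
      Int.floor_nonneg.2 (div_nonneg (by linarith [hx i]) hh.le)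
    have hlt : ∀ i, ⌊(x i - a i) / (s / K)⌋.toNat < K := by
      intro i
      rw [Int.toNat_lt (h0 i), Int.floor_lt, div_lt_iff₀ hh]
      have : (K : ℝ) * (s / K) = s := by field_simp
      push_cast
      linarith [hx i]
    refine ⟨fun i => ⟨_, hlt i⟩, fun i => ?_⟩
    simp only [Int.toNat_of_nonneg (h0 i)]

theorem restrict_cube_eq_sum (μ : Measure (Fin d → ℝ)) (a : Fin d → ℝ) {s : ℝ} (hs : 0 < s)
    {K : ℕ} (hK : 0 < K) :
    μ.restrict (cube a s) = ∑ z : Fin d → Fin K, μ.restrict (subCell a s z) := by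
  have hh : 0 < s / K := by positivity
  rw [← iUnion_subCell a hs hK, Measure.restrict_iUnion, Measure.sum_fintype]
  · intro z z' hz
    refine disjoint_gridCell hh fun h => hz (funext fun i => Fin.ext ?_)
    have := congrFun h i
    simpa using this
  · exact fun z => measurableSet_cube _ _

/-- The index of the dyadic block of side length `2 ^ j` of cells. -/
def blockIndex {K : ℕ} (j : ℕ) (z : Fin d → Fin K) : Fin d → Fin K :=
  fun i => ⟨z i / 2 ^ j, (Nat.div_le_self _ _).trans_lt (z i).2⟩

theorem blockIndex_succ {K : ℕ} (j : ℕ) (z z' : Fin d → Fin K)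
    (h : blockIndex j z = blockIndex j z') : blockIndex (j + 1) z = blockIndex (j + 1) z' := by
  funext i
  have := congrArg Fin.val (congrFun h i)
  simp only [blockIndex] at this
  simp only [blockIndex, Fin.mk.injEq]
  rw [pow_succ, ← Nat.div_div_eq_div_mul, this, Nat.div_div_eq_div_mul]

theorem blockIndex_const {K : ℕ} {j : ℕ} (hj : K ≤ 2 ^ j) (z z' : Fin d → Fin K) :
    blockIndex j z = blockIndex j z' := by
  funext i
  simp only [blockIndex, Fin.mk.injEq]
  rw [Nat.div_eq_of_lt ((z i).2.trans_le hj), Nat.div_eq_of_lt ((z' i).2.trans_le hj)]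

/-- There are at most `K / 2 ^ j + 1` values per coordinate; since `2 ^ j ≤ K`, the `+ 1` is
absorbed by the factor `2`. -/
theorem card_image_blockIndex {K : ℕ} (j : ℕ) (hj : 2 ^ j ≤ K) :
    ((Finset.univ.image (blockIndex (d := d) (K := K) j)).card : ℝ) ≤ (2 * K / 2 ^ j) ^ d := by
  have h1 : (Finset.univ.image (blockIndex (d := d) (K := K) j)).card ≤ (K / 2 ^ j + 1) ^ d := by
    have hsub : (Finset.univ.image (blockIndex (d := d) (K := K) j)).card ≤
        (Fintype.piFinset fun _ : Fin d => Finset.range (K / 2 ^ j + 1)).card := by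
      refine Finset.card_le_card_of_injOn (fun z i => (z i : ℕ)) ?_ ?_
      · intro z hz
        simp only [Finset.coe_image, Finset.coe_univ, Set.image_univ, Set.mem_range] at hz
        obtain ⟨y, rfl⟩ := hz
        simp only [Finset.mem_coe, Fintype.mem_piFinset, Finset.mem_range, blockIndex]
        exact fun i => Nat.lt_succ_of_le (Nat.div_le_div_right (y i).2.le)
      · intro z _ z' _ h
        exact funext fun i => Fin.ext (congrFun h i)
    simpa using hsub
  refine (Nat.cast_le.2 h1).trans ?_
  push_cast
  gcongr
  have h2 : ((K / 2 ^ j : ℕ) : ℝ) ≤ K / 2 ^ j := by exact_mod_cast Nat.cast_div_le (α := ℝ)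
  have h3 : (1 : ℝ) ≤ K / 2 ^ j := by
    rw [one_le_div (by positivity)]; exact_mod_cast hj
  calc ((K / 2 ^ j : ℕ) : ℝ) + 1 ≤ K / 2 ^ j + K / 2 ^ j := add_le_add h2 h3
    _ = 2 * K / 2 ^ j := by ring

theorem abs_sub_le_of_blockIndex_eq (a : Fin d → ℝ) {s : ℝ} (hs : 0 < s) {K : ℕ} (hK : 0 < K)
    (j : ℕ) {z z' : Fin d → Fin K} (h : blockIndex j z = blockIndex j z') {x y : Fin d → ℝ}
    (hx : x ∈ subCell a s z) (hy : y ∈ subCell a s z') (i : Fin d) :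
    |x i - y i| ≤ 2 ^ j * s / K := by
  have hK' : (0 : ℝ) < K := by positivity
  have hh : 0 < s / K := by positivity
  have key : ∀ {z : Fin d → Fin K} {x : Fin d → ℝ}, x ∈ subCell a s z →
      a i + s / K * (2 ^ j * (z i / 2 ^ j : ℕ)) ≤ x i ∧
      x i < a i + s / K * (2 ^ j * ((z i / 2 ^ j : ℕ) + 1)) := by
    intro z x hx
    rw [subCell, gridCell, mem_cube] at hx
    obtain ⟨h1, h2⟩ := hx i
    push_cast at h1 h2
    have h3 : (2 : ℝ) ^ j * (z i / 2 ^ j : ℕ) ≤ (z i : ℕ) := by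
      exact_mod_cast Nat.mul_div_le _ _
    have h4 : ((z i : ℕ) : ℝ) + 1 ≤ 2 ^ j * ((z i / 2 ^ j : ℕ) + 1) := by
      exact_mod_cast Nat.lt_mul_div_succ (z i : ℕ) (by positivity : 0 < 2 ^ j)
    constructor
    · refine le_trans ?_ h1
      gcongr
    · refine h2.trans_le ?_
      rw [add_assoc, ← mul_add_one]
      gcongr
  have hq : (z i : ℕ) / 2 ^ j = z' i / 2 ^ j := congrArg Fin.val (congrFun h i)
  obtain ⟨h1, h2⟩ := key hx
  obtain ⟨h3, h4⟩ := key hy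
  rw [← hq] at h3 h4
  have : 2 ^ j * s / K = s / K * (2 ^ j * ((z i / 2 ^ j : ℕ) + 1)) -
      s / K * (2 ^ j * (z i / 2 ^ j : ℕ)) := by ring
  rw [abs_le, this]
  constructor <;> linarith

end Cubes

/-! ### Upper and lower bounds of order `N ^ (-p / d)`, and the recursion for the uniform law. -/

section Grid

variable {d : ℕ}

/-- The cost of transporting a unit mass inside a block of side length `2 ^ j` of cells. -/
noncomputable def blockCost (B p s : ℝ) (K j : ℕ) : ℝ≥0∞ :=
  ENNReal.ofReal ((B * (2 ^ j * s / K)) ^ p)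

/-- The constant in the bound for the cost of the hierarchical matching. -/
noncomputable def matchingConst (d : ℕ) (B p : ℝ) : ℝ :=
  B ^ p + (2 * B) ^ p * 2 ^ ((d : ℝ) / 2) / (1 - 2 ^ (-((d : ℝ) / 2 - p)))

theorem two_rpow_neg_lt_one {p : ℝ} (hpd : p < (d : ℝ) / 2) :
    (2 : ℝ) ^ (-((d : ℝ) / 2 - p)) < 1 :=
  Real.rpow_lt_one_of_one_lt_of_neg (by norm_num) (by linarith)

theorem matchingConst_pos {p B : ℝ} (hB : 0 < B) (hpd : p < (d : ℝ) / 2) :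
    0 < matchingConst d B p := by
  have : 0 < 1 - (2 : ℝ) ^ (-((d : ℝ) / 2 - p)) := by linarith [two_rpow_neg_lt_one hpd]
  unfold matchingConst
  positivity

/-- Here `T` is the block side at one level: its surplus is moved inside blocks of side `2 * T`. All
dependence on `T` is in the last factor, whose exponent is negative when `p < d / 2`. -/
theorem level_cost_eq {p B s K N T : ℝ} (hB : 0 < B) (hs : 0 < s) (hK : 0 < K) (hN : 0 < N)
    (hT : 0 < T) :
    (B * (2 * T * s / K)) ^ p * √((2 * K / T) ^ d / N) =
      ((2 * B) ^ p * 2 ^ ((d : ℝ) / 2)) * s ^ p * K ^ ((d : ℝ) / 2 - p) * N ^ (-(1 / 2) : ℝ) *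
        T ^ (-((d : ℝ) / 2 - p)) := by
  refine Real.log_injOn_pos (Set.mem_Ioi.2 (by positivity)) (Set.mem_Ioi.2 (by positivity)) ?_
  simp (disch := positivity) only [Real.log_mul, Real.log_div, Real.log_rpow, Real.log_sqrt,
    Real.log_pow]
  ring

theorem leaf_cost_eq {p B s K N : ℝ} (hB : 0 < B) (hs : 0 < s) (hK : 0 < K) (hN : 0 < N) :
    (B * (s / K)) ^ p * √(K ^ d / N) =
      B ^ p * s ^ p * K ^ ((d : ℝ) / 2 - p) * N ^ (-(1 / 2) : ℝ) := by
  refine Real.log_injOn_pos (Set.mem_Ioi.2 (by positivity)) (Set.mem_Ioi.2 (by positivity)) ?_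
  simp (disch := positivity) only [Real.log_mul, Real.log_div, Real.log_rpow, Real.log_sqrt,
    Real.log_pow]
  ring

/-- The levels add up to a geometric series with ratio `r < 1`, so the total is comparable to the
finest level, uniformly in the number of levels. -/
theorem grid_leftover_le {p B s : ℝ} (hpd : p < (d : ℝ) / 2) (hB : 0 < B)
    (hs : 0 < s) {K N : ℕ} (hK : 0 < K) (hN : N ≠ 0) :
    blockCost B p s K 0 * ENNReal.ofReal √(Fintype.card (Fin d → Fin K) / N) +
      ∑ i ∈ Finset.range (Nat.clog 2 K), blockCost B p s K (i + 1) *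
        ENNReal.ofReal √((Finset.univ.image (blockIndex (d := d) (K := K) i)).card / N) ≤
    ENNReal.ofReal (matchingConst d B p * s ^ p * K ^ ((d : ℝ) / 2 - p) *
      (N : ℝ) ^ (-(1 / 2) : ℝ)) := by
  have hK' : (0 : ℝ) < K := by positivity
  have hN' : (0 : ℝ) < N := by positivity
  have hr := two_rpow_neg_lt_one hpd
  set r : ℝ := (2 : ℝ) ^ (-((d : ℝ) / 2 - p)) with hrdef
  have hr0 : 0 ≤ r := by positivity
  set M : ℝ := ((2 * B) ^ p * 2 ^ ((d : ℝ) / 2)) * s ^ p * K ^ ((d : ℝ) / 2 - p) *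
    (N : ℝ) ^ (-(1 / 2) : ℝ) with hM
  have hM0 : 0 ≤ M := by positivity
  have hterm : ∀ i ∈ Finset.range (Nat.clog 2 K), blockCost B p s K (i + 1) *
      ENNReal.ofReal √((Finset.univ.image (blockIndex (d := d) (K := K) i)).card / N) ≤
      ENNReal.ofReal (M * r ^ i) := by
    intro i hi
    have hi' : 2 ^ i < K := (Nat.lt_clog_iff_pow_lt (by norm_num)).1 (Finset.mem_range.1 hi)
    have hT : (0 : ℝ) < 2 ^ i := by positivity
    rw [blockCost, ← ENNReal.ofReal_mul (by positivity)]
    refine ENNReal.ofReal_le_ofReal ?_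
    calc (B * (2 ^ (i + 1) * s / K)) ^ p *
          √((Finset.univ.image (blockIndex (d := d) (K := K) i)).card / N)
        ≤ (B * (2 * 2 ^ i * s / K)) ^ p * √((2 * K / 2 ^ i) ^ d / N) := by
          rw [pow_succ' (2 : ℝ) i]
          gcongr
          exact card_image_blockIndex i hi'.le
      _ = M * r ^ i := by
          rw [level_cost_eq hB hs hK' hN' hT, hrdef, ← Real.rpow_natCast, ← Real.rpow_natCast,
            ← Real.rpow_mul (by norm_num), ← Real.rpow_mul (by norm_num), mul_comm (i : ℝ)]
  have hsum : ∑ i ∈ Finset.range (Nat.clog 2 K), M * r ^ i ≤ M / (1 - r) := by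
    rw [← Finset.mul_sum, div_eq_mul_inv]
    gcongr
    rw [← tsum_geometric_of_lt_one hr0 hr]
    exact (summable_geometric_of_lt_one hr0 hr).sum_le_tsum _ fun _ _ => by positivity
  refine (add_le_add (le_of_eq ?_) ((Finset.sum_le_sum hterm).trans_eq
    (ENNReal.ofReal_sum_of_nonneg fun i _ => by positivity).symm)).trans
    ((add_le_add_right (ENNReal.ofReal_le_ofReal hsum) _).trans_eq
      (ENNReal.ofReal_add (p := B ^ p * s ^ p * K ^ ((d : ℝ) / 2 - p) * (N : ℝ) ^ (-(1 / 2) : ℝ))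
        (by positivity) (div_nonneg hM0 (by linarith))).symm) |>.trans_eq ?_
  · rw [blockCost, ← ENNReal.ofReal_mul (by positivity), pow_zero, one_mul,
      ← leaf_cost_eq hB hs hK' hN']
    simp
  · rw [hM, matchingConst]
    congr 1
    ring

theorem costFn_le_blockCost (nrm : Seminorm ℝ (Fin d → ℝ)) {p : ℝ} (hp : 0 ≤ p) {B : ℝ}
    (hB : 0 < B) (hnB : ∀ x, nrm x ≤ B * ‖x‖) (a : Fin d → ℝ) {s : ℝ} (hs : 0 < s) {K : ℕ}
    (hK : 0 < K) (j : ℕ) (z z' : Fin d → Fin K) (h : blockIndex j z = blockIndex j z') :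
    ∀ x ∈ subCell a s z, ∀ y ∈ subCell a s z', costFn nrm p (x, y) ≤ blockCost B p s K j :=
  fun x hx y hy => costFn_le nrm hp hB hnB (by positivity)
    (abs_sub_le_of_blockIndex_eq a hs hK j h hx hy)

theorem subCell_compl_null {μ : Measure (Fin d → ℝ)} {a : Fin d → ℝ} {s : ℝ} (hs : 0 < s) {K : ℕ}
    (hK : 0 < K) {z : Fin d → Fin K} (h : μ (subCell a s z)ᶜ = 0) :
    μ (Set.Icc a fun i => a i + s)ᶜ = 0 := by
  refine measure_mono_null (Set.compl_subset_compl.2 (subset_trans ?_ (cube_subset_Icc a s))) h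
  rw [← iUnion_subCell a hs hK]
  exact Set.subset_iUnion (fun z => subCell a s z) z

/-- The mean transport cost for a measure on a cube is of order at most `N ^ (-p / d)`. -/
theorem exists_meanCost_le (nrm : Seminorm ℝ (Fin d → ℝ)) {p : ℝ} (hp : 0 ≤ p)
    (hpd : p < (d : ℝ) / 2) :
    ∃ C : ℝ, 0 < C ∧ ∀ (a : Fin d → ℝ) (s : ℝ), 0 < s → ∀ (μ : Measure (Fin d → ℝ))
      [IsProbabilityMeasure μ], μ (cube a s)ᶜ = 0 → ∀ N : ℕ, N ≠ 0 →
      meanCost (costFn nrm p) μ N ≤ ENNReal.ofReal (C * s ^ p * (N : ℝ) ^ (-(p / d))) := by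
  obtain ⟨B, hB, hnB⟩ := exists_seminorm_le nrm
  have hC := matchingConst_pos hB hpd
  have hd : (0 : ℝ) < d := by linarith
  refine ⟨B ^ p + matchingConst d B p * 2 ^ ((d : ℝ) / 2 - p), by positivity,
    fun a s hs μ _ hμ N hN => ?_⟩
  have hN' : (0 : ℝ) < N := by positivity
  have hN1 : (1 : ℝ) ≤ N := by exact_mod_cast Nat.one_le_iff_ne_zero.2 hN
  have hroot1 : 1 ≤ (N : ℝ) ^ (1 / (d : ℝ)) := Real.one_le_rpow hN1 (by positivity)
  -- About one point per cell: the cost inside the cells and the cost of the hierarchy are then both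
  -- of order `N ^ (-p / d)`.
  set K : ℕ := ⌈(N : ℝ) ^ (1 / (d : ℝ))⌉₊ with hKdef
  have hK : 0 < K := Nat.ceil_pos.2 (by linarith)
  have hK1 : (N : ℝ) ^ (1 / (d : ℝ)) ≤ K := Nat.le_ceil _
  have hK2 : (K : ℝ) ≤ 2 * (N : ℝ) ^ (1 / (d : ℝ)) := by
    have := Nat.ceil_lt_add_one (show 0 ≤ (N : ℝ) ^ (1 / (d : ℝ)) by positivity)
    linarith
  classical
  set w : (Fin d → Fin K) → ℝ≥0 := fun z => (μ (subCell a s z)).toNNReal with hw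
  have hwe : ∀ z, (w z : ℝ≥0∞) = μ (subCell a s z) := fun z =>
    ENNReal.coe_toNNReal (measure_ne_top _ _)
  set ν : (Fin d → Fin K) → Measure (Fin d → ℝ) := fun z =>
    if w z = 0 then Measure.dirac (fun i => a i + s / K * ((z i : ℕ) : ℤ))
    else ProbabilityTheory.cond μ (subCell a s z) with hν
  have hms : ∀ z : Fin d → Fin K, MeasurableSet (subCell a s z) := fun z => measurableSet_cube _ _
  have hνp : ∀ z, IsProbabilityMeasure (ν z) := by
    intro z
    simp only [hν]
    split_ifs with h
    · infer_instance
    · refine ProbabilityTheory.cond_isProbabilityMeasure fun h0 => h ?_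
      rw [← ENNReal.coe_eq_zero, hwe, h0]
  have hνS : ∀ z, ν z (subCell a s z)ᶜ = 0 := by
    intro z
    simp only [hν]
    split_ifs with h
    · rw [Measure.dirac_apply' _ (hms z).compl, Set.indicator_of_notMem]
      simp only [Set.mem_compl_iff, not_not, subCell, gridCell, mem_cube]
      intro i
      have : 0 < s / K := by positivity
      constructor <;> linarith
    · rw [ProbabilityTheory.cond_apply (hms z)]
      simp
  have hsum : ∑ z, w z • ν z = μ := by
    have h1 : μ.restrict (cube a s) = μ :=
      Measure.restrict_eq_self_of_ae_mem (show ∀ᵐ x ∂μ, x ∈ cube a s from hμ)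
    conv_rhs => rw [← h1, restrict_cube_eq_sum μ a hs hK]
    refine Finset.sum_congr rfl fun z _ => ?_
    simp only [hν]
    split_ifs with h
    · rw [h, zero_smul, eq_comm, Measure.restrict_eq_zero, ← hwe, h, ENNReal.coe_zero]
    · rw [ProbabilityTheory.cond, ENNReal.smul_def, hwe, smul_smul, ENNReal.mul_inv_cancel,
        one_smul]
      · rw [← hwe]; simpa using h
      · exact measure_ne_top _ _
  have hw1 : ∑ z, w z = 1 := by
    rw [← ENNReal.coe_inj, ← sum_smul_univ Finset.univ w ν, hsum, measure_univ, ENNReal.coe_one]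
  have hbound := meanCost_mixture_le_of_diam (continuous_costFn nrm hp) (costFn_ne_top nrm)
    (K := Set.Icc a fun i => a i + s) isCompact_Icc ν
    (fun z => subCell_compl_null hs hK (hνS z)) (fun z => subCell a s z) hνS blockIndex
    blockIndex_succ (blockCost B p s K) (costFn_le_blockCost nrm hp hB hnB a hs hK)
    (Nat.clog 2 K) (blockIndex_const (Nat.le_pow_clog (by norm_num) K)) w hw1 hN
  rw [hsum] at hbound
  refine hbound.trans ((add_le_add_right (grid_leftover_le hpd hB hs hK hN) _).trans ?_)
  rw [blockCost, ← ENNReal.ofReal_add (by positivity) (by positivity)]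
  refine ENNReal.ofReal_le_ofReal ?_
  have e1 : (B * (2 ^ 0 * s / K)) ^ p ≤ B ^ p * s ^ p * (N : ℝ) ^ (-(p / d)) := by
    calc (B * (2 ^ 0 * s / K)) ^ p ≤ (B * (s / (N : ℝ) ^ (1 / (d : ℝ)))) ^ p := by
          rw [pow_zero, one_mul]; gcongr
      _ = _ := by
          refine Real.log_injOn_pos (Set.mem_Ioi.2 (by positivity))
            (Set.mem_Ioi.2 (by positivity)) ?_
          simp (disch := positivity) only [Real.log_mul, Real.log_div, Real.log_rpow]
          ring
  have e2 : matchingConst d B p * s ^ p * K ^ ((d : ℝ) / 2 - p) * (N : ℝ) ^ (-(1 / 2) : ℝ) ≤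
      matchingConst d B p * 2 ^ ((d : ℝ) / 2 - p) * s ^ p * (N : ℝ) ^ (-(p / d)) := by
    calc _ ≤ matchingConst d B p * s ^ p * (2 * (N : ℝ) ^ (1 / (d : ℝ))) ^ ((d : ℝ) / 2 - p) *
          (N : ℝ) ^ (-(1 / 2) : ℝ) := by
          have : 0 ≤ (d : ℝ) / 2 - p := by linarith
          gcongr
      _ = _ := by
          refine Real.log_injOn_pos (Set.mem_Ioi.2 (by positivity))
            (Set.mem_Ioi.2 (by positivity)) ?_
          simp (disch := positivity) only [Real.log_mul, Real.log_rpow]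
          field_simp
          ring
  calc _ ≤ _ := add_le_add e1 e2
    _ = _ := by ring

/-- Decomposition of the uniform distribution on the unit cube. -/
theorem unif_eq_sum_subCell {K : ℕ} (hK : 0 < K) :
    unif (cube (0 : Fin d → ℝ) 1) =
      ∑ z : Fin d → Fin K, ((K : ℝ≥0) ^ d)⁻¹ • unif (subCell (0 : Fin d → ℝ) 1 z) := by
  have hh : (0 : ℝ) < 1 / K := by positivity
  rw [unif_cube, restrict_cube_eq_sum volume 0 one_pos hK, ENNReal.ofReal_one, one_pow, inv_one,
    one_smul]
  refine Finset.sum_congr rfl fun z _ => ?_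
  rw [subCell, gridCell, volume_restrict_cube _ hh, ENNReal.smul_def]
  congr 1
  rw [one_div, ENNReal.ofReal_inv_of_pos (by positivity), ENNReal.ofReal_natCast,
    ENNReal.coe_inv (by positivity), ENNReal.coe_pow, ENNReal.coe_natCast, ENNReal.inv_pow]

/-- The recursive inequality for the uniform distribution. -/
theorem exists_meanCost_unif_le (nrm : Seminorm ℝ (Fin d → ℝ)) {p : ℝ} (hp : 0 ≤ p)
    (hpd : p < (d : ℝ) / 2) :
    ∃ C : ℝ, 0 < C ∧ ∀ (K N m : ℕ) (θ : ℝ), 0 < K → N ≠ 0 → m ≠ 0 → 0 < θ →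
      (m : ℝ) * K ^ d ≤ (1 - θ) * N →
      meanCost (costFn nrm p) (unif (cube (0 : Fin d → ℝ) 1)) N ≤
        ENNReal.ofReal ((K : ℝ) ^ (-p)) *
          meanCost (costFn nrm p) (unif (cube (0 : Fin d → ℝ) 1)) m +
        ENNReal.ofReal (C * (K : ℝ) ^ (d - p) / (θ ^ 2 * N) +
          C * (K : ℝ) ^ ((d : ℝ) / 2 - p) * (N : ℝ) ^ (-(1 / 2) : ℝ)) := by
  obtain ⟨B, hB, hnB⟩ := exists_seminorm_le nrm
  have hC := matchingConst_pos hB hpd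
  refine ⟨B ^ p + matchingConst d B p, by positivity, fun K N m θ hK hN hm hθ hmN => ?_⟩
  have hK' : (0 : ℝ) < K := by positivity
  have hN' : (0 : ℝ) < N := by positivity
  have hh : (0 : ℝ) < 1 / K := by positivity
  have hp' : ∀ z : Fin d → Fin K, IsProbabilityMeasure (unif (subCell (0 : Fin d → ℝ) 1 z)) :=
    fun z => isProbabilityMeasure_unif _ hh
  have hS : ∀ z : Fin d → Fin K,
      unif (subCell (0 : Fin d → ℝ) 1 z) (subCell (0 : Fin d → ℝ) 1 z)ᶜ = 0 :=
    fun z => unif_cube_compl _ _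
  have hw1 : ∑ _z : Fin d → Fin K, ((K : ℝ≥0) ^ d)⁻¹ = 1 := by
    simp only [Finset.sum_const, Finset.card_univ, Fintype.card_fun, Fintype.card_fin,
      nsmul_eq_mul, Nat.cast_pow]
    exact mul_inv_cancel₀ (by positivity)
  have hbound := meanCost_mixture_le_of_meanCost (continuous_costFn nrm hp) (costFn_ne_top nrm)
    (K := Set.Icc 0 fun i => (0 : Fin d → ℝ) i + 1) isCompact_Icc
    (fun z : Fin d → Fin K => unif (subCell (0 : Fin d → ℝ) 1 z))
    (fun z => subCell_compl_null one_pos hK (hS z)) (fun z => subCell 0 1 z) hS blockIndex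
    blockIndex_succ (blockCost B p 1 K) (costFn_le_blockCost nrm hp hB hnB 0 one_pos hK)
    (Nat.clog 2 K) (blockIndex_const (Nat.le_pow_clog (by norm_num) K))
    (fun _ => ((K : ℝ≥0) ^ d)⁻¹) hw1 hN hθ (fun _ => m) (fun z _ => ⟨hm, by
      push_cast
      rw [mul_right_comm, ← div_eq_mul_inv, le_div_iff₀ (by positivity)]
      exact hmN⟩)
  rw [← unif_eq_sum_subCell hK] at hbound
  refine hbound.trans ((add_le_add_right (grid_leftover_le hpd hB one_pos hK hN) _).trans ?_)
  rw [Finset.sum_add_distrib, ← Finset.mul_sum, add_assoc]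
  refine add_le_add ?_ ?_
  · refine (mul_le_mul_right (Finset.sum_le_sum fun z _ =>
      meanCost_unif_cube_le nrm hp _ hh m) _).trans_eq ?_
    rw [Finset.sum_const, Finset.card_univ, Fintype.card_fun, Fintype.card_fin, nsmul_eq_mul,
      ← mul_assoc, Fintype.card_fin, ENNReal.coe_inv (by positivity), Nat.cast_pow,
      ENNReal.coe_pow, ENNReal.coe_natCast, ENNReal.inv_mul_cancel
      (by simpa using fun h : K = 0 => (hK.ne' h).elim) (by simp), one_mul, one_div,
      Real.inv_rpow hK'.le, Real.rpow_neg hK'.le]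
  · rw [Finset.sum_const, Finset.card_univ, Fintype.card_fun, Fintype.card_fin, nsmul_eq_mul,
      blockCost, ← ENNReal.ofReal_mul (by positivity), Fintype.card_fin, ← ENNReal.ofReal_natCast,
      ← ENNReal.ofReal_mul (by positivity), ← ENNReal.ofReal_add (by positivity) (by positivity)]
    refine ENNReal.ofReal_le_ofReal (add_le_add ?_ ?_)
    · have : (((K ^ d : ℕ) : ℝ)) * ((B * (2 ^ 0 * 1 / K)) ^ p * (1 / (θ ^ 2 * N))) =
          B ^ p * (K : ℝ) ^ (d - p) / (θ ^ 2 * N) := by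
        push_cast
        refine Real.log_injOn_pos (Set.mem_Ioi.2 (by positivity))
          (Set.mem_Ioi.2 (by positivity)) ?_
        simp (disch := positivity) only [Real.log_mul, Real.log_div, Real.log_rpow, Real.log_pow,
          Real.log_one]
        push_cast
        ring
      rw [this]
      gcongr
      linarith
    · rw [Real.one_rpow, mul_one]
      gcongr
      have : 0 < B ^ p := by positivity
      linarith

/-- The mean transport cost for the uniform distribution is of order at least `N ^ (-p / d)`. -/
theorem exists_le_meanCost_unif (nrm : Seminorm ℝ (Fin d → ℝ)) (hnrm : ∀ x, nrm x = 0 → x = 0)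
    {p : ℝ} (hp : 0 ≤ p) (hd : 0 < d) :
    ∃ C : ℝ, 0 < C ∧ ∀ N : ℕ, N ≠ 0 → ENNReal.ofReal (C * (N : ℝ) ^ (-(p / d))) ≤
      meanCost (costFn nrm p) (unif (cube (0 : Fin d → ℝ) 1)) N := by
  obtain ⟨b, hb, hbn⟩ := exists_le_seminorm nrm hnrm
  have hd' : (0 : ℝ) < d := by positivity
  refine ⟨(b / 2 * 2 ^ (-(1 / d) : ℝ)) ^ p / 2, by positivity, fun N hN => ?_⟩
  have hN' : (0 : ℝ) < N := by positivity
  have := isProbabilityMeasure_unif (0 : Fin d → ℝ) one_pos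
  set U := unif (cube (0 : Fin d → ℝ) 1) with hU
  -- Chosen so that the `N` sup-norm balls of radius `r` have total volume `N * (2 * r) ^ d = 1 /
  -- 2`. At least half of the mass then has to travel farther than `r`.
  set r : ℝ := (2 * N : ℝ) ^ (-(1 / d) : ℝ) / 2 with hr
  have hr0 : 0 < r := by positivity
  have hrd : (2 * r) ^ d = 1 / (2 * N) := by
    rw [hr, mul_div_cancel₀ _ two_ne_zero, ← Real.rpow_natCast, ← Real.rpow_mul (by positivity)]
    rw [neg_mul, one_div_mul_cancel hd'.ne', Real.rpow_neg_one, one_div]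
  have hconst : (b / 2 * 2 ^ (-(1 / d) : ℝ)) ^ p / 2 * (N : ℝ) ^ (-(p / d)) =
      (b * r) ^ p * (1 / 2) := by
    refine Real.log_injOn_pos (Set.mem_Ioi.2 (by positivity)) (Set.mem_Ioi.2 (by positivity)) ?_
    simp (disch := positivity) only [hr, Real.log_mul, Real.log_div, Real.log_rpow, Real.log_one]
    ring
  have hpt : ∀ x : Fin N → Fin d → ℝ, ENNReal.ofReal ((b * r) ^ p * (1 / 2)) ≤
      transportCost (costFn nrm p) U (empirical x) := by
    intro x
    refine le_iInf₂ fun ξ hξ => ?_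
    set G : Set (Fin d → ℝ) := (⋃ i, Metric.closedBall (x i) r)ᶜ with hG
    have hGm : MeasurableSet G :=
      (MeasurableSet.iUnion fun i => Metric.isClosed_closedBall.measurableSet).compl
    have hUG : ENNReal.ofReal (1 / 2) ≤ U G := by
      have hball : ∀ i, U (Metric.closedBall (x i) r) ≤ ENNReal.ofReal (1 / (2 * N)) := by
        intro i
        rw [hU, unif_cube, ENNReal.ofReal_one, one_pow, inv_one, one_smul]
        refine (Measure.restrict_apply_le _ _).trans_eq ?_
        rw [Real.volume_pi_closedBall _ hr0.le, Fintype.card_fin, hrd]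
      have hun : U (⋃ i, Metric.closedBall (x i) r) ≤ ENNReal.ofReal (1 / 2) := by
        refine (measure_iUnion_fintype_le _ _).trans ((Finset.sum_le_sum fun i _ =>
          hball i).trans_eq ?_)
        rw [Finset.sum_const, Finset.card_univ, Fintype.card_fin, nsmul_eq_mul,
          ← ENNReal.ofReal_natCast, ← ENNReal.ofReal_mul (by positivity)]
        congr 1
        field_simp
      rw [hG, prob_compl_eq_one_sub (MeasurableSet.iUnion fun i =>
        Metric.isClosed_closedBall.measurableSet)]
      refine le_trans (le_of_eq ?_) (tsub_le_tsub_left hun 1)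
      rw [← ENNReal.ofReal_one, ← ENNReal.ofReal_sub _ (by norm_num)]
      norm_num
    have hrange : ∀ᵐ z ∂ξ, z.2 ∈ Set.range x := by
      have h1 : ∀ᵐ y ∂ξ.snd, y ∈ Set.range x := by
        rw [hξ.2]
        show empirical x (Set.range x)ᶜ = 0
        rw [empirical, Measure.smul_apply, Measure.finsetSum_apply, Finset.sum_eq_zero, smul_zero]
        intro i _
        simp
      exact ae_of_ae_map measurable_snd.aemeasurable h1
    calc ENNReal.ofReal ((b * r) ^ p * (1 / 2))
        ≤ ENNReal.ofReal ((b * r) ^ p) * U G := by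
          rw [ENNReal.ofReal_mul (by positivity)]; gcongr
      _ = ENNReal.ofReal ((b * r) ^ p) * ξ (Prod.fst ⁻¹' G) := by
          rw [← hξ.1, Measure.fst_apply hGm]
      _ = ∫⁻ z, (Prod.fst ⁻¹' G).indicator (fun _ => ENNReal.ofReal ((b * r) ^ p)) z ∂ξ := by
          rw [lintegral_indicator_const (measurable_fst hGm)]
      _ ≤ ∫⁻ z, costFn nrm p z ∂ξ := by
          refine lintegral_mono_ae ?_
          filter_upwards [hrange] with z hz
          refine Set.indicator_apply_le fun hzG => ENNReal.ofReal_le_ofReal ?_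
          refine Real.rpow_le_rpow (by positivity) (le_trans ?_ (hbn _)) hp
          gcongr
          obtain ⟨i, hi⟩ := hz
          simp only [hG, Set.mem_preimage, Set.mem_compl_iff, Set.mem_iUnion,
            Metric.mem_closedBall, not_exists, not_le] at hzG
          rw [← hi, ← dist_eq_norm]
          exact (hzG i).le
  rw [hconst, meanCost]
  calc _ = ∫⁻ _ : Fin N → Fin d → ℝ, ENNReal.ofReal ((b * r) ^ p * (1 / 2))
        ∂(Measure.pi fun _ => U) := by simp
    _ ≤ _ := lintegral_mono hpt

end Grid

/-! ### Existence of the limit for the uniform law. -/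

section Limit

/-- An approximately recursively bounded sequence converges. -/
theorem exists_tendsto_of_recursive {g : ℕ → ℝ} {c C : ℝ} (hc : ∀ᶠ N in atTop, c ≤ g N)
    (hC : ∀ᶠ N in atTop, g N ≤ C) (q : ℝ → ℝ) (hq : Tendsto q (𝓝[>] 0) (𝓝 1)) (R : ℝ → ℕ → ℝ)
    (hR : ∀ θ, 0 < θ → Tendsto (R θ) atTop (𝓝 0))
    (h : ∀ θ, 0 < θ → θ < 1 → ∀ m : ℕ, m ≠ 0 → ∀ᶠ N in atTop, g N ≤ q θ * g m + R θ m) :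
    ∃ L, c ≤ L ∧ Tendsto g atTop (𝓝 L) := by
  have hbl : IsBoundedUnder (· ≥ ·) atTop g := ⟨c, by simpa using hc⟩
  have hbu : IsBoundedUnder (· ≤ ·) atTop g := ⟨C, by simpa using hC⟩
  set L := liminf g atTop with hL
  have hcL : c ≤ L := le_liminf_of_le hbu.isCoboundedUnder_ge hc
  refine ⟨L, hcL, ?_⟩
  rw [tendsto_order]
  refine ⟨fun a ha => eventually_lt_of_lt_liminf ha hbl, fun a ha => ?_⟩
  obtain ⟨ε, hε, hεa⟩ : ∃ ε > 0, L + 3 * ε ≤ a := ⟨(a - L) / 3, by linarith, by linarith⟩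
  -- A large `m` with `g m` close to the liminf is fixed; the recursion then bounds `g N` for all
  -- large `N` by `L + 3 * ε`.
  have hfreq : ∃ᶠ m in atTop, g m < L + ε := frequently_lt_of_liminf_lt hbu.isCoboundedUnder_ge
    (by linarith)
  obtain ⟨θ, hθq, hθ⟩ : ∃ θ, (0 ≤ q θ ∧ q θ * (L + ε) < L + 2 * ε) ∧ 0 < θ ∧ θ < 1 := by
    have h1 : ∀ᶠ θ in 𝓝[>] (0 : ℝ), q θ * (L + ε) < L + 2 * ε := by
      have := hq.mul_const (L + ε)
      exact this.eventually_lt_const (by linarith)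
    have h2 : ∀ᶠ θ in 𝓝[>] (0 : ℝ), 0 ≤ q θ :=
      (hq.eventually_const_lt one_pos).mono fun _ h => h.le
    have h3 : ∀ᶠ θ in 𝓝[>] (0 : ℝ), θ ∈ Set.Ioo (0 : ℝ) 1 := Ioo_mem_nhdsGT one_pos
    obtain ⟨θ, hθ⟩ := (h1.and (h2.and h3)).exists
    exact ⟨θ, ⟨hθ.2.1, hθ.1⟩, hθ.2.2⟩
  have hRe : ∀ᶠ m in atTop, R θ m < ε := (hR θ hθ.1).eventually_lt_const hε
  obtain ⟨m, hm1, hm2, hm0⟩ := (hfreq.and_eventually (hRe.and (eventually_ne_atTop 0))).exists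
  filter_upwards [h θ hθ.1 hθ.2 m hm0] with N hN
  have : q θ * g m ≤ q θ * (L + ε) := mul_le_mul_of_nonneg_left hm1.le hθq.1
  linarith

variable {d : ℕ}

/-- Take `K = ⌊((1 - θ) * N / m) ^ (1 / d)⌋`. The first bound is the requirement of the recursion;
the second says that rounding costs at most another factor `1 - θ` once `N` is large. -/
theorem exists_floor_root (hd : 0 < d) {θ : ℝ} (hθ : 0 < θ) (hθ1 : θ < 1) {m : ℕ} (hm : m ≠ 0) :
    ∀ᶠ N : ℕ in atTop, ∃ K : ℕ, 0 < K ∧ (m : ℝ) * K ^ d ≤ (1 - θ) * N ∧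
      (1 - θ) ^ 2 * N ≤ m * (K : ℝ) ^ d := by
  have hd' : (0 : ℝ) < d := by positivity
  have hm' : (0 : ℝ) < m := by positivity
  have hθ' : 0 < 1 - θ := by linarith
  set y : ℕ → ℝ := fun N => ((1 - θ) * N / m) ^ (1 / d : ℝ) with hy
  have hytop : Tendsto y atTop atTop := by
    refine (tendsto_rpow_atTop (by positivity)).comp ?_
    refine Tendsto.atTop_div_const hm' ?_
    exact Tendsto.const_mul_atTop hθ' tendsto_natCast_atTop_atTop
  have hratio : Tendsto (fun N => ((⌊y N⌋₊ : ℝ) / y N) ^ d) atTop (𝓝 (1 ^ d)) :=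
    ((tendsto_nat_floor_div_atTop (R := ℝ)).comp hytop).pow d
  rw [one_pow] at hratio
  filter_upwards [hratio.eventually_const_lt (show 1 - θ < 1 by linarith),
    hytop.eventually_ge_atTop 1] with N h1 h2
  have hyd : y N ^ d = (1 - θ) * N / m := by
    rw [hy]
    dsimp only
    rw [← Real.rpow_natCast, ← Real.rpow_mul (by positivity), one_div_mul_cancel hd'.ne',
      Real.rpow_one]
  have hy0 : 0 < y N := by linarith
  refine ⟨⌊y N⌋₊, Nat.floor_pos.2 h2, ?_, ?_⟩
  · calc (m : ℝ) * (⌊y N⌋₊ : ℝ) ^ d ≤ m * y N ^ d := by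
          gcongr; exact Nat.floor_le hy0.le
      _ = _ := by rw [hyd]; field_simp
  · rw [div_pow, lt_div_iff₀ (by positivity), hyd] at h1
    calc (1 - θ) ^ 2 * N = m * ((1 - θ) * ((1 - θ) * N / m)) := by field_simp
      _ ≤ _ := by gcongr

theorem tendsto_natCast_rpow_zero {e : ℝ} (he : e < 0) :
    Tendsto (fun N : ℕ => (N : ℝ) ^ e) atTop (𝓝 0) := by
  have := (tendsto_rpow_neg_atTop (y := -e) (by linarith)).comp (tendsto_natCast_atTop_atTop (R := ℝ))
  rw [neg_neg] at this
  exact this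

/-- The mean transport cost of the uniform distribution is asymptotically a constant multiple of
`N ^ (-p / d)`. -/
theorem exists_tendsto_meanCost_unif (nrm : Seminorm ℝ (Fin d → ℝ))
    (hnrm : ∀ x, nrm x = 0 → x = 0) {p : ℝ} (hp : 0 < p) (hpd : p < (d : ℝ) / 2) :
    ∃ L : ℝ, 0 < L ∧ Tendsto (fun N : ℕ => (N : ℝ≥0∞) ^ (p / d) *
      meanCost (costFn nrm p) (unif (cube (0 : Fin d → ℝ) 1)) N) atTop (𝓝 (ENNReal.ofReal L)) := by
  have hd' : (0 : ℝ) < d := by linarith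
  have hd : 0 < d := by exact_mod_cast hd'
  have hq1 : p / d - 1 / 2 < 0 := by
    rw [sub_neg, div_lt_iff₀ hd']; linarith
  obtain ⟨C₁, hC₁, hup⟩ := exists_meanCost_le nrm hp.le hpd
  obtain ⟨c, hc, hlow⟩ := exists_le_meanCost_unif nrm hnrm hp.le hd
  obtain ⟨C, hC, hrec⟩ := exists_meanCost_unif_le nrm hp.le hpd
  set V : ℕ → ℝ≥0∞ := meanCost (costFn nrm p) (unif (cube (0 : Fin d → ℝ) 1)) with hV
  have := isProbabilityMeasure_unif (0 : Fin d → ℝ) one_pos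
  have hup' : ∀ N : ℕ, N ≠ 0 → V N ≤ ENNReal.ofReal (C₁ * (N : ℝ) ^ (-(p / d))) := by
    intro N hN
    have := hup 0 1 one_pos _ (unif_cube_compl 0 1) N hN
    rwa [Real.one_rpow, mul_one] at this
  have htop : ∀ N : ℕ, N ≠ 0 → V N ≠ ∞ := fun N hN =>
    ne_top_of_le_ne_top ENNReal.ofReal_ne_top (hup' N hN)
  set v : ℕ → ℝ := fun N => (V N).toReal with hv
  have hv0 : ∀ N, 0 ≤ v N := fun N => ENNReal.toReal_nonneg
  have hinv : ∀ N : ℕ, N ≠ 0 → (N : ℝ) ^ (p / d) * (N : ℝ) ^ (-(p / d)) = 1 := by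
    intro N hN
    have : (0 : ℝ) < N := by positivity
    rw [← Real.rpow_add this, add_neg_cancel, Real.rpow_zero]
  set g : ℕ → ℝ := fun N => (N : ℝ) ^ (p / d) * v N with hg
  have hgN : ∀ N, g N = (N : ℝ) ^ (p / d) * v N := fun N => rfl
  have hvV : ∀ N, N ≠ 0 → ENNReal.ofReal (v N) = V N := fun N hN => ENNReal.ofReal_toReal (htop N hN)
  have hgc : ∀ᶠ N in atTop, c ≤ g N := by
    filter_upwards [eventually_ne_atTop 0] with N hN
    have h1 : c * (N : ℝ) ^ (-(p / d)) ≤ v N :=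
      (ENNReal.ofReal_le_iff_le_toReal (htop N hN)).1 (hlow N hN)
    calc c = (N : ℝ) ^ (p / d) * (c * (N : ℝ) ^ (-(p / d))) := by
          rw [mul_left_comm, hinv N hN, mul_one]
      _ ≤ _ := by rw [hgN]; gcongr
  have hgC : ∀ᶠ N in atTop, g N ≤ C₁ := by
    filter_upwards [eventually_ne_atTop 0] with N hN
    have h1 : v N ≤ C₁ * (N : ℝ) ^ (-(p / d)) :=
      ENNReal.toReal_le_of_le_ofReal (by positivity) (hup' N hN)
    calc g N ≤ (N : ℝ) ^ (p / d) * (C₁ * (N : ℝ) ^ (-(p / d))) := by rw [hgN]; gcongr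
      _ = C₁ := by rw [mul_left_comm, hinv N hN, mul_one]
  have hrec' : ∀ (K N m : ℕ) (θ : ℝ), 0 < K → N ≠ 0 → m ≠ 0 → 0 < θ →
      (m : ℝ) * K ^ d ≤ (1 - θ) * N → v N ≤ (K : ℝ) ^ (-p) * v m +
        (C * (K : ℝ) ^ (d - p) / (θ ^ 2 * N) +
          C * (K : ℝ) ^ ((d : ℝ) / 2 - p) * (N : ℝ) ^ (-(1 / 2) : ℝ)) := by
    intro K N m θ hK hN hm hθ hmN
    refine ENNReal.toReal_le_of_le_ofReal (by have := hv0 m; positivity) ?_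
    refine (hrec K N m θ hK hN hm hθ hmN).trans_eq ?_
    rw [ENNReal.ofReal_add (p := (K : ℝ) ^ (-p) * v m) (by have := hv0 m; positivity)
      (by positivity), ENNReal.ofReal_mul (p := (K : ℝ) ^ (-p)) (by positivity), hvV m hm]
  obtain ⟨L, hcL, hL⟩ := exists_tendsto_of_recursive hgc hgC (fun θ => ((1 - θ) ^ 2)⁻¹ ^ (p / d))
    (by
      have : ContinuousAt (fun θ : ℝ => ((1 - θ) ^ 2)⁻¹ ^ (p / d)) 0 := by
        refine ContinuousAt.rpow_const (ContinuousAt.inv₀ (by fun_prop) (by norm_num))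
          (Or.inl (by norm_num))
      have h := this.tendsto
      simp only [sub_zero, one_pow, inv_one, Real.one_rpow] at h
      exact h.mono_left nhdsWithin_le_nhds)
    (fun θ m => C / θ ^ 2 * (m : ℝ) ^ (p / d - 1) + C * (m : ℝ) ^ (p / d - 1 / 2))
    (fun θ hθ => by
      have h1 := (tendsto_natCast_rpow_zero (e := p / d - 1) (by linarith)).const_mul (C / θ ^ 2)
      have h2 := (tendsto_natCast_rpow_zero hq1).const_mul C
      simpa using h1.add h2)
    (fun θ hθ hθ1 m hm => by
      filter_upwards [exists_floor_root hd hθ hθ1 hm, eventually_ne_atTop 0] with N hK hN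
      obtain ⟨K, hK, hK1, hK2⟩ := hK
      have hN' : (0 : ℝ) < N := by positivity
      have hK' : (0 : ℝ) < K := by positivity
      have hm' : (0 : ℝ) < m := by positivity
      have hθ' : 0 < 1 - θ := by linarith
      -- The mean number of points per cell. After multiplication by `N ^ (p / d)` all coefficients
      -- depend on `K` and `N` only through `r`, which lies between `m` and `((1 - θ) ^ 2)⁻¹ * m`;
      -- the error exponents are negative, so `r` may be replaced by `m`.
      set r : ℝ := N / (K : ℝ) ^ d with hr
      have hr0 : 0 < r := by positivity
      have hmr : (m : ℝ) ≤ r := by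
        rw [hr, le_div_iff₀ (by positivity)]
        nlinarith
      have hrm : r ≤ ((1 - θ) ^ 2)⁻¹ * m := by
        rw [hr, div_le_iff₀ (by positivity), mul_assoc, ← div_eq_inv_mul,
          le_div_iff₀ (by positivity)]
        linarith
      have e1 : (N : ℝ) ^ (p / d) * (K : ℝ) ^ (-p) = r ^ (p / d) := by
        refine Real.log_injOn_pos (Set.mem_Ioi.2 (by positivity))
          (Set.mem_Ioi.2 (by positivity)) ?_
        simp (disch := positivity) only [hr, Real.log_mul, Real.log_div, Real.log_rpow,
          Real.log_pow]
        field_simp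
        ring
      have e2 : (N : ℝ) ^ (p / d) * (C * (K : ℝ) ^ (d - p) / (θ ^ 2 * N)) =
          C / θ ^ 2 * r ^ (p / d - 1) := by
        refine Real.log_injOn_pos (Set.mem_Ioi.2 (by positivity))
          (Set.mem_Ioi.2 (by positivity)) ?_
        simp (disch := positivity) only [hr, Real.log_mul, Real.log_div, Real.log_rpow,
          Real.log_pow]
        field_simp
        ring
      have e3 : (N : ℝ) ^ (p / d) *
          (C * (K : ℝ) ^ ((d : ℝ) / 2 - p) * (N : ℝ) ^ (-(1 / 2) : ℝ)) =
          C * r ^ (p / d - 1 / 2) := by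
        refine Real.log_injOn_pos (Set.mem_Ioi.2 (by positivity))
          (Set.mem_Ioi.2 (by positivity)) ?_
        simp (disch := positivity) only [hr, Real.log_mul, Real.log_div, Real.log_rpow,
          Real.log_pow]
        field_simp
        ring
      calc g N ≤ (N : ℝ) ^ (p / d) * ((K : ℝ) ^ (-p) * v m +
            (C * (K : ℝ) ^ (d - p) / (θ ^ 2 * N) +
            C * (K : ℝ) ^ ((d : ℝ) / 2 - p) * (N : ℝ) ^ (-(1 / 2) : ℝ))) := by
            rw [hgN]; gcongr; exact hrec' K N m θ hK hN hm hθ hK1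
        _ = r ^ (p / d) * v m + (C / θ ^ 2 * r ^ (p / d - 1) + C * r ^ (p / d - 1 / 2)) := by
            rw [mul_add, mul_add, e2, e3, ← mul_assoc, e1]
        _ ≤ (((1 - θ) ^ 2)⁻¹ * m) ^ (p / d) * v m +
            (C / θ ^ 2 * (m : ℝ) ^ (p / d - 1) + C * (m : ℝ) ^ (p / d - 1 / 2)) := by
            have h2 : r ^ (p / d - 1) ≤ (m : ℝ) ^ (p / d - 1) :=
              Real.rpow_le_rpow_of_nonpos hm' hmr (by linarith)
            have h3 : r ^ (p / d - 1 / 2) ≤ (m : ℝ) ^ (p / d - 1 / 2) :=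
              Real.rpow_le_rpow_of_nonpos hm' hmr hq1.le
            have := hv0 m
            gcongr
        _ = _ := by rw [Real.mul_rpow (by positivity) (by positivity), mul_assoc])
  refine ⟨L, hc.trans_le hcL, ?_⟩
  refine (ENNReal.tendsto_ofReal hL).congr' ?_
  filter_upwards [eventually_ne_atTop 0] with N hN
  have hN' : (0 : ℝ) < N := by positivity
  rw [hgN, ENNReal.ofReal_mul (by positivity), hvV N hN,
    ← ENNReal.ofReal_rpow_of_pos hN', ENNReal.ofReal_natCast]

end Limit

/-! ### Asymptotics of the mean cost for a fixed finite mixture. -/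

section MixtureLimit

variable {I : Type*} [Fintype I] [DecidableEq I] {d : ℕ}
  {c : (Fin d → ℝ) × (Fin d → ℝ) → ℝ≥0∞}

theorem exists_cost_le_of_isCompact (hc : Continuous c) (hc' : ∀ z, c z ≠ ∞)
    {K : Set (Fin d → ℝ)} (hK : IsCompact K) :
    ∃ D : ℝ≥0, ∀ x ∈ K, ∀ y ∈ K, c (x, y) ≤ D := by
  rcases (K ×ˢ K).eq_empty_or_nonempty with h | h
  · refine ⟨0, fun x hx y hy => ?_⟩
    have : (x, y) ∈ K ×ˢ K := ⟨hx, hy⟩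
    simp [h] at this
  · obtain ⟨z, _, hz⟩ := (hK.prod hK).exists_isMaxOn h hc.continuousOn
    refine ⟨(c z).toNNReal, fun x hx y hy => ?_⟩
    rw [ENNReal.coe_toNNReal (hc' z)]
    exact hz (⟨hx, hy⟩ : (x, y) ∈ K ×ˢ K)

theorem tendsto_error_term {q : ℝ} (hq : q < 1 / 2) (A B C : ℝ) :
    Tendsto (fun N : ℕ => (N : ℝ) ^ q * (A * (1 / (B * N)) + C * √(1 / N))) atTop (𝓝 0) := by
  have h1 := (tendsto_natCast_rpow_zero (e := q - 1) (by linarith)).const_mul (A / B)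
  have h2 := (tendsto_natCast_rpow_zero (e := q - 1 / 2) (by linarith)).const_mul C
  have h := h1.add h2
  rw [mul_zero, mul_zero, add_zero] at h
  refine h.congr' ?_
  filter_upwards [eventually_ne_atTop 0] with N hN
  have hN' : (0 : ℝ) < N := by positivity
  rw [Real.rpow_sub hN', Real.rpow_sub hN', Real.rpow_one, ← Real.sqrt_eq_rpow,
    Real.sqrt_div zero_le_one, Real.sqrt_one, mul_add]
  congr 1
  · rw [one_div, mul_inv]; ring
  · ring

/-- The asymptotics of the mean transport cost of a mixture. -/
theorem limsup_meanCost_mixture_le (hc : Continuous c) (hc' : ∀ z, c z ≠ ∞)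
    {K : Set (Fin d → ℝ)} (hK : IsCompact K) (μ : I → Measure (Fin d → ℝ))
    [∀ k, IsProbabilityMeasure (μ k)] (hμK : ∀ k, μ k Kᶜ = 0) (w : I → ℝ≥0) (hw : ∑ k, w k = 1)
    {q : ℝ} (hq : 0 < q) (hq2 : q < 1 / 2) (f : I → ℕ → ℝ≥0∞)
    (hf : ∀ k, ∀ m, m ≠ 0 → meanCost c (μ k) m ≤ f k m)
    (ℓ : I → ℝ≥0∞) (hℓ : ∀ k, ℓ k ≠ ∞)
    (hlim : ∀ k, Tendsto (fun m : ℕ => (m : ℝ≥0∞) ^ q * f k m) atTop (𝓝 (ℓ k))) :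
    limsup (fun N : ℕ => (N : ℝ≥0∞) ^ q * meanCost c (∑ k, w k • μ k) N) atTop ≤
      ∑ k, (w k : ℝ≥0∞) ^ (1 - q) * ℓ k := by
  obtain ⟨D, hD⟩ := exists_cost_le_of_isCompact hc hc' hK
  have hne : Nonempty I := by
    by_contra h
    rw [not_nonempty_iff] at h
    simp at hw
  obtain ⟨k₀⟩ := hne
  suffices hθ : ∀ θ : ℝ, 0 < θ → θ < 1 →
      limsup (fun N : ℕ => (N : ℝ≥0∞) ^ q * meanCost c (∑ k, w k • μ k) N) atTop ≤
        ENNReal.ofReal ((1 - θ) ^ (-q)) * ∑ k, (w k : ℝ≥0∞) ^ (1 - q) * ℓ k by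
    have ht : Tendsto (fun θ : ℝ => ENNReal.ofReal ((1 - θ) ^ (-q)) *
        ∑ k, (w k : ℝ≥0∞) ^ (1 - q) * ℓ k) (𝓝[>] 0)
        (𝓝 (1 * ∑ k, (w k : ℝ≥0∞) ^ (1 - q) * ℓ k)) := by
      refine ENNReal.Tendsto.mul_const ?_ (Or.inl one_ne_zero)
      have : ContinuousAt (fun θ : ℝ => (1 - θ) ^ (-q)) 0 :=
        ContinuousAt.rpow_const (by fun_prop) (Or.inl (by norm_num))
      have h := ENNReal.tendsto_ofReal this.tendsto
      simp only [sub_zero, Real.one_rpow, ENNReal.ofReal_one] at h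
      exact h.mono_left nhdsWithin_le_nhds
    rw [one_mul] at ht
    refine ge_of_tendsto ht ?_
    filter_upwards [Ioo_mem_nhdsGT (one_pos (α := ℝ))] with θ h using hθ θ h.1 h.2
  intro θ hθ hθ1
  have hθ' : 0 < 1 - θ := by linarith
  -- A sample size that component `k` reaches with high probability; the factor `1 - θ` is removed
  -- at the end by letting `θ → 0`.
  set m : I → ℕ → ℕ := fun k N => ⌊(1 - θ) * w k * N⌋₊ with hm
  set n : ℕ := Fintype.card I
  have hmt : ∀ k, w k ≠ 0 → Tendsto (m k) atTop atTop := by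
    intro k hk
    have : (0 : ℝ) < w k := by positivity
    exact tendsto_nat_floor_atTop.comp
      (Tendsto.const_mul_atTop (by positivity) tendsto_natCast_atTop_atTop)
  have hmr : ∀ k, w k ≠ 0 → Tendsto (fun N : ℕ => ((N : ℝ) / m k N) ^ q) atTop
      (𝓝 (((1 - θ) * w k) ^ (-q))) := by
    intro k hk
    have hwk : (0 : ℝ) < w k := by positivity
    have h1 := (tendsto_nat_floor_mul_div_atTop (R := ℝ) (a := (1 - θ) * w k)
      (by positivity)).comp (tendsto_natCast_atTop_atTop (R := ℝ))
    have h2 := (h1.inv₀ (by positivity)).rpow_const (p := q) (Or.inl (by positivity))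
    rw [Real.inv_rpow (by positivity), ← Real.rpow_neg (by positivity)] at h2
    refine h2.congr fun N => ?_
    simp [hm]
  set err : ℕ → ℝ := fun N => (N : ℝ) ^ q * (n * D * (1 / (θ ^ 2 * N)) + D * √n * √(1 / N))
  set H : ℕ → ℝ≥0∞ := fun N => ∑ k, (if w k = 0 then 0 else
    w k * (ENNReal.ofReal (((N : ℝ) / m k N) ^ q) * ((m k N : ℝ≥0∞) ^ q * f k (m k N)))) +
      ENNReal.ofReal (err N) with hH
  have hHt : Tendsto H atTop (𝓝 (∑ k, (if w k = 0 then 0 else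
      w k * (ENNReal.ofReal (((1 - θ) * w k) ^ (-q)) * ℓ k)) + ENNReal.ofReal 0)) := by
    refine Tendsto.add (tendsto_finsetSum _ fun k _ => ?_)
      (ENNReal.tendsto_ofReal (tendsto_error_term hq2 _ _ _))
    by_cases hk : w k = 0
    · simp [hk]
    simp only [hk, if_false]
    refine ENNReal.Tendsto.const_mul (ENNReal.Tendsto.mul (ENNReal.tendsto_ofReal (hmr k hk))
      (Or.inr (hℓ k)) ((hlim k).comp (hmt k hk)) (Or.inr ENNReal.ofReal_ne_top))
      (Or.inr ENNReal.coe_ne_top)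
  have hle : ∀ᶠ N : ℕ in atTop, (N : ℝ≥0∞) ^ q * meanCost c (∑ k, w k • μ k) N ≤ H N := by
    have hm0 : ∀ᶠ N : ℕ in atTop, ∀ k, w k ≠ 0 → m k N ≠ 0 := by
      refine eventually_all.2 fun k => ?_
      by_cases hk : w k = 0
      · exact Eventually.of_forall fun N h => (h hk).elim
      · exact ((hmt k hk).eventually_ne_atTop 0).mono fun N h _ => h
    filter_upwards [hm0, eventually_ne_atTop 0] with N hmN hN
    have hN' : (0 : ℝ) < N := by positivity
    have hNq : (N : ℝ≥0∞) ^ q = ENNReal.ofReal ((N : ℝ) ^ q) := by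
      rw [← ENNReal.ofReal_rpow_of_pos hN', ENNReal.ofReal_natCast]
    -- The number of components is fixed, so no hierarchy is needed: one class with diameter bound
    -- `D` leaves an error of order `N ^ (-1 / 2)`, negligible against `N ^ (-q)`.
    have hb := meanCost_mixture_le_of_meanCost hc hc' hK μ hμK (fun _ => K) hμK
      (fun _ _ => k₀) (fun _ _ _ _ => rfl) (fun _ => (D : ℝ≥0∞)) (fun _ _ _ _ => hD) 0
      (fun _ _ => rfl) w hw hN hθ (fun k => m k N)
      (fun k hk => ⟨hmN k hk, Nat.floor_le (by positivity)⟩)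
    rw [Finset.range_zero, Finset.sum_empty, add_zero, Finset.sum_add_distrib, add_assoc] at hb
    refine (mul_le_mul_right hb _).trans ?_
    rw [mul_add, hH]
    refine add_le_add ?_ (le_of_eq ?_)
    · rw [Finset.mul_sum]
      refine Finset.sum_le_sum fun k _ => ?_
      split_ifs with hk
      · simp [hk]
      · have hmk : (0 : ℝ) < m k N := by have := hmN k hk; positivity
        have hsplit : (N : ℝ≥0∞) ^ q =
            ENNReal.ofReal (((N : ℝ) / m k N) ^ q) * (m k N : ℝ≥0∞) ^ q := by
          rw [hNq, ← ENNReal.ofReal_natCast (m k N), ENNReal.ofReal_rpow_of_pos hmk,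
            ← ENNReal.ofReal_mul (by positivity), ← Real.mul_rpow (by positivity) hmk.le,
            div_mul_cancel₀ _ hmk.ne']
        rw [hsplit, mul_left_comm, mul_assoc]
        gcongr
        exact hf k _ (hmN k hk)
    · rw [Finset.sum_const, Finset.card_univ, nsmul_eq_mul, hNq, ← ENNReal.ofReal_coe_nnreal,
        ← ENNReal.ofReal_natCast, ← ENNReal.ofReal_mul (by positivity),
        ← ENNReal.ofReal_mul (by positivity), ← ENNReal.ofReal_mul (by positivity),
        ← ENNReal.ofReal_add (by positivity) (by positivity), ← ENNReal.ofReal_mul (by positivity)]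
      congr 2
      rw [div_eq_mul_one_div (n : ℝ) N, Real.sqrt_mul (Nat.cast_nonneg _)]
      ring
  refine ((limsup_le_limsup hle).trans_eq hHt.limsup_eq).trans_eq ?_
  rw [ENNReal.ofReal_zero, add_zero, Finset.mul_sum]
  refine Finset.sum_congr rfl fun k _ => ?_
  split_ifs with hk
  · rw [hk, ENNReal.coe_zero, ENNReal.zero_rpow_of_pos (by linarith), zero_mul, mul_zero]
  · have hwk : (0 : ℝ) < w k := by positivity
    rw [← mul_assoc, ← mul_assoc]
    congr 1
    rw [← ENNReal.ofReal_coe_nnreal, ENNReal.ofReal_rpow_of_pos hwk,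
      ← ENNReal.ofReal_mul (by positivity), ← ENNReal.ofReal_mul (by positivity)]
    congr 1
    rw [Real.mul_rpow hθ'.le hwk.le, Real.rpow_sub hwk, Real.rpow_one, Real.rpow_neg hwk.le]
    ring

end MixtureLimit

/-! ### Measures approachable from below: reduction to one grid, absolute continuity. -/

section Approachable

variable {d : ℕ}

theorem sum_volume_restrict_gridCell_le {h : ℝ} (hh : 0 < h) (Z : Finset (Fin d → ℤ))
    {s : Set (Fin d → ℝ)} (hs : ∀ z ∈ Z, gridCell 0 h z ⊆ s) :
    ∑ z ∈ Z, volume.restrict (gridCell 0 h z) ≤ volume.restrict s := by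
  have : ∑ z ∈ Z, volume.restrict (gridCell 0 h z) =
      volume.restrict (⋃ z ∈ Z, gridCell (0 : Fin d → ℝ) h z) := by
    classical
    induction Z using Finset.induction_on with
    | empty => simp
    | insert z Z hz ih =>
      rw [Finset.sum_insert hz, ih fun z hz => hs z (Finset.mem_insert_of_mem hz),
        Finset.set_biUnion_insert, Measure.restrict_union]
      · rw [Set.disjoint_iUnion₂_right]
        exact fun z' hz' => disjoint_gridCell hh fun heq => hz (heq ▸ hz')
      · exact Finset.measurableSet_biUnion _ fun _ _ => measurableSet_cube _ _
  rw [this]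
  exact Measure.restrict_mono (Set.iUnion₂_subset hs) le_rfl

/-- The indices of the cells of the grid of mesh size `h` that are contained in a cube. -/
noncomputable def innerCells (a : Fin d → ℝ) (s h : ℝ) : Finset (Fin d → ℤ) :=
  Fintype.piFinset fun i => Finset.Ico ⌈a i / h⌉ ⌊(a i + s) / h⌋

theorem gridCell_subset_cube {a : Fin d → ℝ} {s h : ℝ} (hh : 0 < h) {z : Fin d → ℤ}
    (hz : z ∈ innerCells a s h) : gridCell 0 h z ⊆ cube a s := by
  intro x hx
  rw [gridCell, mem_cube] at hx
  rw [mem_cube]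
  intro i
  have hzi := Finset.mem_Ico.1 (Fintype.mem_piFinset.1 hz i)
  have h1 : a i / h ≤ z i := Int.ceil_le.1 hzi.1
  have h2 : ((z i + 1 : ℤ) : ℝ) ≤ (a i + s) / h := Int.le_floor.1 hzi.2
  rw [div_le_iff₀ hh] at h1
  rw [le_div_iff₀ hh] at h2
  push_cast at h2
  have := hx i
  simp only [Pi.zero_apply, zero_add] at this
  constructor <;> nlinarith

/-- Rounding loses less than one mesh at each end of a side, leaving at least `s / h - 2` cells per
coordinate. -/
theorem card_innerCells_ge {a : Fin d → ℝ} {s h : ℝ} (hh : 0 < h) (hs : 2 * h ≤ s) :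
    (s - 2 * h) ^ d ≤ h ^ d * (innerCells a s h).card := by
  rw [innerCells, Fintype.card_piFinset]
  push_cast
  have hsh : 0 ≤ s / h - 2 := by
    rw [sub_nonneg, le_div_iff₀ hh]; exact hs
  calc (s - 2 * h) ^ d = h ^ d * ∏ _i : Fin d, (s / h - 2) := by
        rw [Finset.prod_const, Finset.card_univ, Fintype.card_fin, ← mul_pow]
        congr 1
        field_simp
    _ ≤ _ := by
        gcongr with i
        rw [Int.card_Ico]
        have h1 := Int.ceil_lt_add_one (a i / h)
        have h2 := Int.sub_one_lt_floor ((a i + s) / h)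
        have h3 : ((⌊(a i + s) / h⌋ - ⌈a i / h⌉ : ℤ) : ℝ) ≤
            ((⌊(a i + s) / h⌋ - ⌈a i / h⌉).toNat : ℝ) := by
          exact_mod_cast Int.self_le_toNat _
        push_cast at h3
        have h4 : (a i + s) / h = a i / h + s / h := add_div _ _ _
        linarith

/-- A measure that is approachable from below is approximated from below by a mixture of uniform
distributions on the cells of a grid. -/
theorem ApproachableFromBelow.exists_gridCell {μ : Measure (Fin d → ℝ)} [IsProbabilityMeasure μ]
    (hμ : ApproachableFromBelow μ) {ε : ℝ} (hε : 0 < ε) :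
    ∃ (h : ℝ) (Z : Finset (Fin d → ℤ)) (β : (Fin d → ℤ) → ℝ≥0), 0 < h ∧
      ∑ z ∈ Z, β z • unif (gridCell 0 h z) ≤ μ ∧ (1 : ℝ) ≤ ∑ z ∈ Z, (β z : ℝ) + ε := by
  classical
  obtain ⟨n, a, s, α, hs, hα, hle, hmass⟩ := hμ (ε / 2) (by positivity)
  have hmass' : (1 : ℝ) ≤ ∑ k, α k + ε / 2 := by
    have hp := fun k => isProbabilityMeasure_unif (a k) (hs k)
    set ν := ∑ k, ENNReal.ofReal (α k) • unif (cube (a k) (s k)) with hν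
    have hνu : ν Set.univ = ENNReal.ofReal (∑ k, α k) := by
      rw [ENNReal.ofReal_sum_of_nonneg fun k _ => (hα k).le, hν]
      simp [Measure.finsetSum_apply, Measure.smul_apply]
    have : IsFiniteMeasure ν := ⟨by rw [hνu]; exact ENNReal.ofReal_lt_top⟩
    rw [Measure.sub_apply MeasurableSet.univ hle, measure_univ, hνu] at hmass
    have h1 : (1 : ℝ≥0∞) ≤ ENNReal.ofReal (∑ k, α k + ε / 2) := by
      rw [ENNReal.ofReal_add (Finset.sum_nonneg fun k _ => (hα k).le) (by positivity), add_comm]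
      exact tsub_le_iff_right.1 hmass
    rwa [ENNReal.one_le_ofReal] at h1
  -- The inner cells fill at least the fraction `((s k - 2 * h) / s k) ^ d` of cube `k`, which tends
  -- to `1` with `h`. One mesh serves all cubes and uses up the second `ε / 2`.
  obtain ⟨h, hh, hhs, hlim⟩ : ∃ h : ℝ, 0 < h ∧ (∀ k, 2 * h ≤ s k) ∧
      ∑ k, α k ≤ ∑ k, α k * ((s k - 2 * h) / s k) ^ d + ε / 2 := by
    have h1 : Tendsto (fun h : ℝ => ∑ k, α k * ((s k - 2 * h) / s k) ^ d + ε / 2) (𝓝[>] 0)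
        (𝓝 (∑ k, α k * ((s k - 2 * 0) / s k) ^ d + ε / 2)) := by
      refine Tendsto.mono_left (Continuous.tendsto ?_ 0) nhdsWithin_le_nhds
      fun_prop
    have h2 : ∑ k, α k < ∑ k, α k * ((s k - 2 * 0) / s k) ^ d + ε / 2 := by
      have : ∀ k, (s k - 2 * 0) / s k = 1 := fun k => by
        rw [mul_zero, sub_zero, div_self (hs k).ne']
      simp only [this, one_pow, mul_one]
      linarith
    have h3 : ∀ᶠ h : ℝ in 𝓝[>] 0, ∀ k, 2 * h ≤ s k := by
      refine eventually_all.2 fun k => ?_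
      filter_upwards [Ioo_mem_nhdsGT (half_pos (hs k))] with h hh
      linarith [hh.2]
    obtain ⟨h, ⟨ha, hb⟩, hc⟩ := ((h3.and (h1.eventually_const_lt h2)).and
      self_mem_nhdsWithin).exists
    exact ⟨h, hc, ha, hb.le⟩
  -- The mass that the `k`-th uniform component gives to one inner cell.
  set γ : Fin n → ℝ≥0 := fun k => (α k * (h / s k) ^ d).toNNReal with hγ
  have hγr : ∀ k, (γ k : ℝ) = α k * (h / s k) ^ d := fun k =>
    Real.coe_toNNReal _ (by have := hα k; have := hs k; positivity)
  set Z : Fin n → Finset (Fin d → ℤ) := fun k => innerCells (a k) (s k) h with hZ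
  -- The cubes may overlap. A cell collects the mass of every cube containing it, so the resulting
  -- components have disjoint supports.
  have hswap : ∀ {M : Type} [AddCommMonoid M] (F : Fin n → (Fin d → ℤ) → M),
      ∑ z ∈ Finset.univ.biUnion Z, ∑ k, (if z ∈ Z k then F k z else 0) =
        ∑ k, ∑ z ∈ Z k, F k z := by
    intro M _ F
    rw [Finset.sum_comm]
    refine Finset.sum_congr rfl fun k _ => ?_
    rw [← Finset.sum_filter]
    congr 1
    ext z
    simp only [Finset.mem_filter, Finset.mem_biUnion, Finset.mem_univ, true_and]
    exact ⟨fun h => h.2, fun h => ⟨⟨k, h⟩, h⟩⟩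
  refine ⟨h, Finset.univ.biUnion Z, fun z => ∑ k, if z ∈ Z k then γ k else 0, hh, ?_, ?_⟩
  · have hmid : ∑ z ∈ Finset.univ.biUnion Z, (∑ k, if z ∈ Z k then γ k else 0) •
        unif (gridCell 0 h z) = ∑ k, ∑ z ∈ Z k, γ k • unif (gridCell (0 : Fin d → ℝ) h z) := by
      rw [← hswap]
      refine Finset.sum_congr rfl fun z _ => ?_
      rw [Finset.sum_smul]
      refine Finset.sum_congr rfl fun k _ => ?_
      split_ifs <;> simp
    · refine hmid.le.trans (le_trans (Finset.sum_le_sum fun k _ => ?_) hle)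
      have hsk := hs k
      have hαk := hα k
      have h1 : ∀ z, γ k • unif (gridCell 0 h z) = ENNReal.ofReal (α k / s k ^ d) •
          volume.restrict (gridCell (0 : Fin d → ℝ) h z) := by
        intro z
        rw [gridCell, volume_restrict_cube _ hh, smul_smul, ENNReal.smul_def]
        congr 1
        rw [← ENNReal.ofReal_pow hh.le, ← ENNReal.ofReal_mul (by positivity),
          ← ENNReal.ofReal_coe_nnreal, hγr]
        congr 1
        rw [div_pow]; ring
      simp only [h1]
      rw [← Finset.smul_sum, unif_cube, smul_smul]
      have h2 : ENNReal.ofReal (α k) * (ENNReal.ofReal (s k) ^ d)⁻¹ =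
          ENNReal.ofReal (α k / s k ^ d) := by
        rw [ENNReal.ofReal_div_of_pos (by positivity), ENNReal.ofReal_pow hsk.le, div_eq_mul_inv]
      rw [h2]
      intro t
      rw [Measure.smul_apply, Measure.smul_apply]
      exact mul_le_mul_right (sum_volume_restrict_gridCell_le hh (Z k)
        (fun z hz => gridCell_subset_cube hh hz) t) _
  · have h1 : ∑ z ∈ Finset.univ.biUnion Z, ((∑ k, if z ∈ Z k then γ k else 0 : ℝ≥0) : ℝ) =
        ∑ k, ∑ z ∈ Z k, (γ k : ℝ) := by
      rw [← hswap]
      refine Finset.sum_congr rfl fun z _ => ?_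
      rw [NNReal.coe_sum]
      refine Finset.sum_congr rfl fun k _ => ?_
      split_ifs <;> simp
    rw [h1]
    have h2 : ∑ k, α k * ((s k - 2 * h) / s k) ^ d ≤ ∑ k, ∑ z ∈ Z k, (γ k : ℝ) := by
      refine Finset.sum_le_sum fun k _ => ?_
      have hsk := hs k
      have hαk := hα k
      rw [Finset.sum_const, nsmul_eq_mul, hγr, div_pow, div_pow]
      calc α k * ((s k - 2 * h) ^ d / s k ^ d)
          ≤ α k * (h ^ d * (innerCells (a k) (s k) h).card / s k ^ d) := by
            gcongr
            exact card_innerCells_ge hh (hhs k)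
        _ = _ := by ring
    linarith

/-- A Lebesgue null set is null for the minorant `ν`, so its `μ`-mass is at most that of `μ - ν`,
which is arbitrarily small. -/
theorem ApproachableFromBelow.absolutelyContinuous {μ : Measure (Fin d → ℝ)}
    [IsProbabilityMeasure μ] (hμ : ApproachableFromBelow μ) : μ ≪ volume := by
  refine Measure.AbsolutelyContinuous.mk fun t ht ht0 => ?_
  refine le_antisymm (ENNReal.le_of_forall_pos_le_add fun ε hε _ => ?_) zero_le
  obtain ⟨n, a, s, α, hs, hα, hle, hmass⟩ := hμ ε (by exact_mod_cast hε)
  have hp := fun k => isProbabilityMeasure_unif (a k) (hs k)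
  set ν := ∑ k, ENNReal.ofReal (α k) • unif (cube (a k) (s k)) with hν
  have hνt : ν t = 0 := by
    rw [hν, Measure.finsetSum_apply]
    refine Finset.sum_eq_zero fun k _ => ?_
    rw [Measure.smul_apply, unif_cube, Measure.smul_apply,
      Measure.absolutelyContinuous_of_le Measure.restrict_le_self ht0, smul_zero, smul_zero]
  have : IsFiniteMeasure ν := isFiniteMeasure_of_le μ hle
  have h1 := Measure.sub_add_cancel_of_le hle
  calc μ t = (μ - ν) t + ν t := by rw [← Measure.add_apply, h1]
    _ ≤ (μ - ν) Set.univ + 0 := add_le_add (measure_mono (Set.subset_univ _)) hνt.le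
    _ ≤ 0 + ε := by
        rw [add_zero, zero_add]
        simpa using hmass

end Approachable

/-! ### The upper bound for measures approachable from below. -/

section UpperBound

variable {d : ℕ}

/-- Lower bound for the functional `∫ (dμ/dλ) ^ (1 - p / d)` in terms of a minorant of `μ`. -/
theorem sum_rpow_le_lintegral_rnDeriv {p : ℝ} (hd : 0 < d) (hpd : p / d < 1)
    {μ : Measure (Fin d → ℝ)} [IsProbabilityMeasure μ] (hac : μ ≪ volume) {h : ℝ} (hh : 0 < h)
    (Z : Finset (Fin d → ℤ)) (β : (Fin d → ℤ) → ℝ≥0)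
    (hle : ∑ z ∈ Z, β z • unif (gridCell 0 h z) ≤ μ) :
    ∑ z ∈ Z, (β z : ℝ≥0∞) ^ (1 - p / d) * ENNReal.ofReal (h ^ p) ≤
      ∫⁻ x, (μ.rnDeriv volume x) ^ (1 - p / (d : ℝ)) ∂volume := by
  have hd' : (0 : ℝ) < d := by positivity
  have hms : ∀ z : Fin d → ℤ, MeasurableSet (gridCell 0 h z) := fun z => measurableSet_cube _ _
  have hfm := Measure.measurable_rnDeriv μ volume
  have hterm : ∀ z ∈ Z, (β z : ℝ≥0∞) ^ (1 - p / d) * ENNReal.ofReal (h ^ p) ≤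
      ∫⁻ x in gridCell 0 h z, (μ.rnDeriv volume x) ^ (1 - p / (d : ℝ)) := by
    intro z hz
    -- On cell `z` the minorant has density `β z / h ^ d`. The exponent `1 - p / d` is positive, so
    -- this bounds the integrand from below.
    have hae : ∀ᵐ x ∂volume.restrict (gridCell 0 h z),
        ENNReal.ofReal (β z / h ^ d) ≤ μ.rnDeriv volume x := by
      refine ae_le_of_forall_setLIntegral_le_of_sigmaFinite measurable_const fun t ht _ => ?_
      rw [Measure.restrict_restrict ht, setLIntegral_const,
        Measure.setLIntegral_rnDeriv hac]
      have hz' : β z • unif (gridCell 0 h z) ≤ μ :=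
        (Finset.single_le_sum (f := fun z => β z • unif (gridCell (0 : Fin d → ℝ) h z))
          (fun _ _ => Measure.zero_le _) hz).trans hle
      refine le_trans (le_of_eq ?_) (hz' (t ∩ gridCell 0 h z))
      rw [Measure.smul_apply, gridCell, unif_cube, Measure.smul_apply, Measure.restrict_apply
        (ht.inter (measurableSet_cube _ _)), Set.inter_assoc, Set.inter_self, ENNReal.smul_def,
        smul_eq_mul, smul_eq_mul, ← mul_assoc, ENNReal.ofReal_div_of_pos (by positivity),
        ENNReal.ofReal_coe_nnreal, ENNReal.ofReal_pow hh.le, div_eq_mul_inv]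
    calc (β z : ℝ≥0∞) ^ (1 - p / d) * ENNReal.ofReal (h ^ p)
        = ∫⁻ _ in gridCell 0 h z, ENNReal.ofReal (β z / h ^ d) ^ (1 - p / (d : ℝ)) := by
          rw [setLIntegral_const, gridCell, volume_cube, ← ENNReal.ofReal_pow hh.le,
            ENNReal.ofReal_rpow_of_nonneg (by positivity) (by linarith),
            ← ENNReal.ofReal_mul (by positivity), ← ENNReal.ofReal_coe_nnreal,
            ENNReal.ofReal_rpow_of_nonneg (by positivity) (by linarith),
            ← ENNReal.ofReal_mul (by positivity), Real.div_rpow (by positivity) (by positivity),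
            div_mul_eq_mul_div, mul_div_assoc]
          congr 2
          refine Real.log_injOn_pos (Set.mem_Ioi.2 (by positivity))
            (Set.mem_Ioi.2 (by positivity)) ?_
          simp (disch := positivity) only [Real.log_div, Real.log_rpow, Real.log_pow]
          field_simp
          ring
      _ ≤ _ := by
          refine lintegral_mono_ae ?_
          filter_upwards [hae] with x hx
          exact ENNReal.rpow_le_rpow hx (by linarith)
  refine (Finset.sum_le_sum hterm).trans ?_
  -- Disjointness of the cells is essential here: the cell integrals add up to at most the full
  -- integral.
  rw [← lintegral_biUnion_finset (fun z _ z' _ hzz' => disjoint_gridCell hh hzz')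
    (fun z _ => hms z)]
  exact setLIntegral_le_lintegral _ _

/-- The asymptotic upper bound for measures that are approachable from below. -/
theorem limsup_meanCost_le_of_approachable (nrm : Seminorm ℝ (Fin d → ℝ)) {p : ℝ} (hp : 0 < p)
    (hpd : p < (d : ℝ) / 2) {L : ℝ}
    (hL : Tendsto (fun N : ℕ => (N : ℝ≥0∞) ^ (p / d) *
      meanCost (costFn nrm p) (unif (cube (0 : Fin d → ℝ) 1)) N) atTop (𝓝 (ENNReal.ofReal L)))
    (μ : Measure (Fin d → ℝ)) [IsProbabilityMeasure μ] {K : Set (Fin d → ℝ)} (hK : IsCompact K)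
    (hμK : μ Kᶜ = 0) (hμ : ApproachableFromBelow μ) :
    limsup (fun N : ℕ => (N : ℝ≥0∞) ^ (p / d) * meanCost (costFn nrm p) μ N) atTop ≤
      ENNReal.ofReal L * ∫⁻ x, (μ.rnDeriv volume x) ^ (1 - p / (d : ℝ)) ∂volume := by
  classical
  have hd' : (0 : ℝ) < d := by linarith
  have hd : 0 < d := by exact_mod_cast hd'
  have hq : 0 < p / d := by positivity
  have hq2 : p / d < 1 / 2 := by rw [div_lt_iff₀ hd']; linarith
  obtain ⟨C, hC, hup⟩ := exists_meanCost_le nrm hp.le hpd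
  obtain ⟨A, S, hS, hμS⟩ : ∃ (A : Fin d → ℝ) (S : ℝ), 0 < S ∧ μ (cube A S)ᶜ = 0 := by
    obtain ⟨R, hR, hKR⟩ := hK.isBounded.subset_ball_lt 0 0
    refine ⟨fun _ => -R, 2 * R, by positivity, measure_mono_null
      (Set.compl_subset_compl.2 fun x hx => mem_cube.2 fun i => ?_) hμK⟩
    have h1 := (norm_le_pi_norm x i).trans_lt (mem_ball_zero_iff.1 (hKR hx))
    rw [Real.norm_eq_abs, abs_lt] at h1
    constructor <;> linarith
  set J := ∫⁻ x, (μ.rnDeriv volume x) ^ (1 - p / (d : ℝ)) ∂volume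
  have hcost := continuous_costFn nrm hp.le
  suffices hε : ∀ ε : ℝ, 0 < ε →
      limsup (fun N : ℕ => (N : ℝ≥0∞) ^ (p / d) * meanCost (costFn nrm p) μ N) atTop ≤
        ENNReal.ofReal (ε ^ (1 - p / d) * (C * S ^ p)) + ENNReal.ofReal L * J by
    have ht : Tendsto (fun ε : ℝ => ENNReal.ofReal (ε ^ (1 - p / d) * (C * S ^ p)) +
        ENNReal.ofReal L * J) (𝓝[>] 0) (𝓝 (0 + ENNReal.ofReal L * J)) := by
      refine Tendsto.add ?_ tendsto_const_nhds
      have hcont : Continuous fun ε : ℝ => ε ^ (1 - p / d) * (C * S ^ p) :=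
        (continuous_id.rpow_const fun _ => Or.inr (by linarith)).mul_const _
      have h := ENNReal.tendsto_ofReal (hcont.tendsto 0)
      rw [Real.zero_rpow (by linarith), zero_mul, ENNReal.ofReal_zero] at h
      exact h.mono_left nhdsWithin_le_nhds
    rw [zero_add] at ht
    refine ge_of_tendsto ht ?_
    filter_upwards [self_mem_nhdsWithin] with ε h using hε ε h
  intro ε hε
  obtain ⟨h, Z, β, hh, hle, hmass⟩ := hμ.exists_gridCell hε
  have hcell : ∀ z, IsProbabilityMeasure (unif (gridCell (0 : Fin d → ℝ) h z)) := fun z =>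
    isProbabilityMeasure_unif _ hh
  set ν := ∑ z ∈ Z, β z • unif (gridCell (0 : Fin d → ℝ) h z) with hν
  have hνu : ν Set.univ = ((∑ z ∈ Z, β z : ℝ≥0) : ℝ≥0∞) := sum_smul_univ Z β _
  have hβ1 : ∑ z ∈ Z, β z ≤ 1 := by
    rw [← ENNReal.coe_le_coe, ← hνu, ENNReal.coe_one, ← measure_univ (μ := μ)]
    exact hle _
  have : IsFiniteMeasure ν := isFiniteMeasure_of_le μ hle
  set ρ : ℝ≥0 := 1 - ∑ z ∈ Z, β z with hρ
  have hρε : (ρ : ℝ) ≤ ε := by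
    rw [hρ, NNReal.coe_sub hβ1, NNReal.coe_one, NNReal.coe_sum]; linarith
  have hsub : μ - ν + ν = μ := Measure.sub_add_cancel_of_le hle
  have hsubu : (μ - ν) Set.univ = ρ := by
    rw [Measure.sub_apply MeasurableSet.univ hle, measure_univ, hνu, hρ, ENNReal.coe_sub,
      ENNReal.coe_one]
  -- The normalised remainder. If `ρ = 0` it has weight zero and any probability measure on the cube
  -- would do.
  set η : Measure (Fin d → ℝ) := if ρ = 0 then μ else (ρ : ℝ≥0∞)⁻¹ • (μ - ν) with hη
  have hηp : IsProbabilityMeasure η := by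
    rw [hη]
    split_ifs with h0
    · infer_instance
    · constructor
      rw [Measure.smul_apply, hsubu, smul_eq_mul, ENNReal.inv_mul_cancel (by simpa using h0)
        ENNReal.coe_ne_top]
  have hρη : ρ • η = μ - ν := by
    rw [hη]
    split_ifs with h0
    · rw [h0, zero_smul, eq_comm, ← Measure.measure_univ_eq_zero, hsubu, h0, ENNReal.coe_zero]
    · rw [ENNReal.smul_def, smul_smul, ENNReal.mul_inv_cancel (by simpa using h0)
        ENNReal.coe_ne_top, one_smul]
  have hηS : η (cube A S)ᶜ = 0 := by
    rw [hη]
    split_ifs with h0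
    · exact hμS
    · have : (μ - ν) (cube A S)ᶜ ≤ μ (cube A S)ᶜ := Measure.sub_le _
      rw [Measure.smul_apply, le_antisymm (this.trans hμS.le) zero_le, smul_zero]
  -- `none` indexes the remainder, `some z` the cells.
  set w : Option Z → ℝ≥0 := fun o => o.elim ρ fun z => β z with hw
  set μs : Option Z → Measure (Fin d → ℝ) := fun o =>
    o.elim η fun z => unif (gridCell 0 h z) with hμs
  have hμsp : ∀ o, IsProbabilityMeasure (μs o) := by
    rintro (_ | z)
    · exact hηp
    · exact hcell z
  have hsum : ∑ o, w o • μs o = μ := by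
    rw [Fintype.sum_option]
    simp only [hw, hμs, Option.elim_none, Option.elim_some]
    rw [Finset.sum_coe_sort Z fun z => β z • unif (gridCell (0 : Fin d → ℝ) h z), hρη]
    exact hsub
  have hw1 : ∑ o, w o = 1 := by
    rw [Fintype.sum_option]
    simp only [hw, Option.elim_none, Option.elim_some]
    rw [Finset.sum_coe_sort Z β, hρ, tsub_add_cancel_of_le hβ1]
  set K' : Set (Fin d → ℝ) := Set.Icc A (fun i => A i + S) ∪
    ⋃ z ∈ Z, Set.Icc (fun i => (0 : Fin d → ℝ) i + h * (z i : ℤ))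
      (fun i => (0 : Fin d → ℝ) i + h * (z i : ℤ) + h) with hK'
  have hK'c : IsCompact K' := isCompact_Icc.union (Z.isCompact_biUnion fun _ _ => isCompact_Icc)
  have hsupp : ∀ o, μs o K'ᶜ = 0 := by
    rintro (_ | z)
    · exact measure_mono_null (Set.compl_subset_compl.2
        ((cube_subset_Icc A S).trans Set.subset_union_left)) hηS
    · refine measure_mono_null (Set.compl_subset_compl.2 ((cube_subset_Icc _ _).trans ?_))
        (unif_cube_compl _ h)
      exact (Set.subset_biUnion_of_mem (u := fun z : Fin d → ℤ =>
        Set.Icc (fun i => (0 : Fin d → ℝ) i + h * (z i : ℤ))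
          (fun i => (0 : Fin d → ℝ) i + h * (z i : ℤ) + h)) z.2).trans Set.subset_union_right
  -- For the remainder only the universal bound of `exists_meanCost_le` is available, with limit `C
  -- * S ^ p`. Each cell scales to the unit cube and has limit `h ^ p * L`.
  have hmain := limsup_meanCost_mixture_le hcost (costFn_ne_top nrm) hK'c μs hsupp w hw1 hq hq2
    (fun o m => o.elim (ENNReal.ofReal (C * S ^ p * (m : ℝ) ^ (-(p / d)))) fun _ =>
      ENNReal.ofReal (h ^ p) * meanCost (costFn nrm p) (unif (cube (0 : Fin d → ℝ) 1)) m)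
    (by
      rintro (_ | z) m hm
      · exact hup A S hS η hηS m hm
      · exact meanCost_unif_cube_le nrm hp.le _ hh m)
    (fun o => o.elim (ENNReal.ofReal (C * S ^ p)) fun _ =>
      ENNReal.ofReal (h ^ p) * ENNReal.ofReal L)
    (by
      rintro (_ | z)
      · exact ENNReal.ofReal_ne_top
      · exact ENNReal.mul_ne_top ENNReal.ofReal_ne_top ENNReal.ofReal_ne_top)
    (by
      rintro (_ | z)
      · refine tendsto_const_nhds.congr' ?_
        filter_upwards [eventually_ne_atTop 0] with m hm
        have hm' : (0 : ℝ) < m := by positivity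
        simp only [Option.elim_none]
        rw [← ENNReal.ofReal_natCast, ENNReal.ofReal_rpow_of_pos hm',
          ← ENNReal.ofReal_mul (by positivity), mul_left_comm, ← Real.rpow_add hm',
          add_neg_cancel, Real.rpow_zero, mul_one]
      · simp only [Option.elim_some]
        refine (ENNReal.Tendsto.const_mul hL (Or.inr ENNReal.ofReal_ne_top)).congr fun m => ?_
        rw [mul_left_comm])
  rw [hsum] at hmain
  refine hmain.trans ?_
  rw [Fintype.sum_option]
  simp only [hw, Option.elim_none, Option.elim_some]
  refine add_le_add ?_ ?_
  · rw [ENNReal.ofReal_mul (p := ε ^ (1 - p / d)) (by positivity)]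
    gcongr
    rw [← ENNReal.ofReal_rpow_of_nonneg hε.le (by linarith)]
    refine ENNReal.rpow_le_rpow ?_ (by linarith)
    rw [← ENNReal.ofReal_coe_nnreal]
    exact ENNReal.ofReal_le_ofReal hρε
  · rw [Finset.sum_coe_sort Z fun z => (β z : ℝ≥0∞) ^ (1 - p / d) *
      (ENNReal.ofReal (h ^ p) * ENNReal.ofReal L)]
    simp only [← mul_assoc]
    rw [← Finset.sum_mul, mul_comm _ (ENNReal.ofReal L)]
    exact mul_le_mul_right (sum_rpow_le_lintegral_rnDeriv hd (by linarith)
      hμ.absolutelyContinuous hh Z β hle) _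

theorem scaled_randError_eq (nrm : Seminorm ℝ (Fin d → ℝ)) {p : ℝ} (hp : 0 < p)
    (μ : Measure (Fin d → ℝ)) (N : ℕ) :
    (N : ℝ≥0∞) ^ (1 / (d : ℝ)) * randError nrm p μ N =
      ((N : ℝ≥0∞) ^ (p / d) * meanCost (costFn nrm p) μ N) ^ (1 / p) := by
  rw [randError_eq nrm hp, ENNReal.mul_rpow_of_nonneg _ _ (by positivity), ← ENNReal.rpow_mul]
  congr 2
  field_simp

end UpperBound

end RandQuant

theorem proposition4p2 (d : ℕ) (p : ℝ) (hp : 1 ≤ p) (hpd : p < (d : ℝ) / 2)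
    (nrm : Seminorm ℝ (Fin d → ℝ)) (hnrm : ∀ x, nrm x = 0 → x = 0) :
    ∃ κ : ℝ, 0 < κ ∧
      Tendsto (fun N : ℕ => (N : ℝ≥0∞) ^ (1 / (d : ℝ)) *
          RandQuant.randError nrm p (RandQuant.unif (RandQuant.cube (0 : Fin d → ℝ) 1)) N)
        atTop (𝓝 (ENNReal.ofReal κ)) ∧
      ∀ (μ : Measure (Fin d → ℝ)) [IsProbabilityMeasure μ],
        (∃ K : Set (Fin d → ℝ), IsCompact K ∧ μ Kᶜ = 0) →
        RandQuant.ApproachableFromBelow μ →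
        μ ≪ volume ∧
        limsup (fun N : ℕ => (N : ℝ≥0∞) ^ (1 / (d : ℝ)) * RandQuant.randError nrm p μ N) atTop ≤
          ENNReal.ofReal κ *
            (∫⁻ x, (μ.rnDeriv volume x) ^ (1 - p / (d : ℝ)) ∂volume) ^ (1 / p) := by
  have hp0 : 0 < p := by linarith
  obtain ⟨L, hL0, hL⟩ := RandQuant.exists_tendsto_meanCost_unif nrm hnrm hp0 hpd
  have hκ : ENNReal.ofReal L ^ (1 / p) = ENNReal.ofReal (L ^ (1 / p)) :=
    ENNReal.ofReal_rpow_of_pos hL0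
  -- The limit `L` belongs to the `p`-th power of the error, so `κ = L ^ (1 / p)`.
  refine ⟨L ^ (1 / p), Real.rpow_pos_of_pos hL0 _, ?_, fun μ _ hμK hμ =>
    ⟨hμ.absolutelyContinuous, ?_⟩⟩
  · simp only [RandQuant.scaled_randError_eq nrm hp0]
    rw [← hκ]
    exact (ENNReal.continuous_rpow_const.tendsto _).comp hL
  · obtain ⟨K, hK, hμK⟩ := hμK
    simp only [RandQuant.scaled_randError_eq nrm hp0]
    have h := RandQuant.limsup_meanCost_le_of_approachable nrm hp0 hpd hL μ hK hμK hμ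
    have hmono : Monotone fun x : ℝ≥0∞ => x ^ (1 / p) :=
      ENNReal.monotone_rpow_of_nonneg (by positivity)
    have hcont : Continuous fun x : ℝ≥0∞ => x ^ (1 / p) := ENNReal.continuous_rpow_const
    -- The `p`-th root is monotone and continuous on `[0, ∞]`, so it passes through the limsup.
    have hmap := hmono.map_limsup_of_continuousAt (F := atTop)
      (fun N : ℕ => (N : ℝ≥0∞) ^ (p / d) * RandQuant.meanCost (RandQuant.costFn nrm p) μ N)
      hcont.continuousAt
    rw [← hκ, ← ENNReal.mul_rpow_of_nonneg _ _ (by positivity)]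
    exact hmap.symm.le.trans (ENNReal.rpow_le_rpow h (by positivity))
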